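/- Let $n\ge 0$ and $d\ge 2$ be integers and let $k=(k_1,\dots,k_{n+1})$ be integers, each coprime to $d$. Let $F_{n+1}$ be the free group on $x_1,\dots,x_{n+1}$. Let $B_{n+1}$ be the braid group with standard generators $s_1,\dots,s_n$, acting on $F_{n+1}$ by Artin's formulae $s_i(x_i)=x_ix_{i+1}x_i^{-1}$, $s_i(x_{i+1})=x_i$, $s_i(x_j)=x_j$ for $j\ne i,i+1$, and let $P_{n+1}=\ker(B_{n+1}\to S_{n+1})$ be the pure braid group. Let $K_0(k,d)$ be the kernel of the homomorphism $F_{n+1}\to \mathbb Z/d\mathbb Z=q^{\mathbb Z}/q^{d\mathbb Z}$, $x_i\mapsto q^{k_i}$. The group $P_{n+1}$ preserves $K_0(k,d)$, and conjugation in $F_{n+1}$ induces an action of $\mathbb Z/d\mathbb Z$ on $V_0=K_0(k,d)^{ab}\otimes\mathbb Q$ which commutes with $P_{n+1}$. Hence $P_{n+1}$ acts $R_d$-linearly on $$V_0^{ni}=V_0/(1+q+\cdots+q^{d-1})V_0,\qquad R_d=\mathbb Q[q]/(1+q+\cdots+q^{d-1}).$$ Let $R=\mathbb Z[X_1^{\pm1},\dots,X_{n+1}^{\pm1}]$,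 the group ring of $F_{n+1}^{ab}$, with field of fractions $\Omega$, and consider the homomorphism $F_{n+1}\to R^{n+1}\rtimes F_{n+1}^{ab}$, $x_i\mapsto(e_i,X_i)$, where $e_1,\dots,e_{n+1}$ is the standard basis of $R^{n+1}$. The Gassner representation of $P_{n+1}$ on $R^{n+1}$ is the $R$-linear action for which $p(e_i)$ is the $R^{n+1}$-component of the image of $p(x_i)$. Put $v_i=(1-X_i)^{-1}e_i$ and $\varepsilon_i=v_i-v_{i+1}$ in $\Omega^{n+1}$. The reduced Gassner representation is the action of $P_{n+1}$ on the free $R$-module $W=\bigoplus_{i=1}^nR\varepsilon_i\subset\Omega^{n+1}$. For units $t_1,\dots,t_{n+1}$ of a commutative ring $A$, its specialisation at $X_i\mapsto t_i$ is the resulting representation on $A^n=\bigoplus_i A\varepsilon_i$. For $e\ge 2$ let $\omega_e$ be a primitive $e$-th root of unity, $E_e=\mathbb Q(\omega_e)$, and let $g_n(k,e)$ be the specialisation at $X_i\mapsto\omega_e^{k_i}$, on $E_e^n$. Then: 1. $V_0^{ni}$ is a free $R_d$-module of rank $n$. 2. As a representation of $P_{n+1}$ over $R_d$, $V_0^{ni}$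 is isomorphic to the reduced Gassner representation specialised at $X_i\mapsto q^{k_i}\in R_d$. 3. There is an isomorphism of representations of $P_{n+1}$ over $\mathbb Q$ $$V_0^{ni}\;\cong\;\bigoplus_{e\mid d,\ e\ge2}g_n(k,e),$$ under which $q$ acts on the summand $g_n(k,e)$ as multiplication by $\omega_e$. -/

import Mathlib

open Polynomial

noncomputable section

namespace PureBraid

/-! ### Braid groups, pure braid groups and Artin's action on the free group -/

/-- The relators of the braid group on `n + 1` strands, on generators `s_i`, `i : Fin n`. -/
def braidRels (n : ℕ) : Set (FreeGroup (Fin n)) :=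
  {r | ∃ i j : Fin n, (i : ℕ) + 2 ≤ j ∧
      r = (FreeGroup.of i * FreeGroup.of j) * (FreeGroup.of j * FreeGroup.of i)⁻¹} ∪
  {r | ∃ i j : Fin n, (i : ℕ) + 1 = j ∧
      r = (FreeGroup.of i * FreeGroup.of j * FreeGroup.of i) *
        (FreeGroup.of j * FreeGroup.of i * FreeGroup.of j)⁻¹}

/-- The braid group `B_{n+1}` on `n + 1` strands. -/
abbrev BraidGroup (n : ℕ) : Type := PresentedGroup (braidRels n)

/-- A map on the generators that satisfies the braid relations extends to `B_{n+1}`. -/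
def braidLift {n : ℕ} {G : Type} [Group G] (f : Fin n → G)
    (hcomm : ∀ i j : Fin n, (i : ℕ) + 2 ≤ j → f i * f j = f j * f i)
    (hbraid : ∀ i j : Fin n, (i : ℕ) + 1 = j → f i * f j * f i = f j * f i * f j) :
    BraidGroup n →* G :=
  PresentedGroup.toGroup (f := f) (by
    rintro r (⟨i, j, hij, rfl⟩ | ⟨i, j, hij, rfl⟩)
    · simp only [map_mul, map_inv, FreeGroup.lift_apply_of]
      rw [hcomm i j hij, mul_inv_cancel]
    · simp only [map_mul, map_inv, FreeGroup.lift_apply_of]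
      rw [hbraid i j hij, mul_inv_cancel])

/-- The endomorphism `a ↦ a b a⁻¹`, `b ↦ a` of a free group fixing all the other generators. -/
def artinHom {α : Type} [DecidableEq α] (a b : α) : FreeGroup α →* FreeGroup α :=
  FreeGroup.lift fun j =>
    if j = a then FreeGroup.of a * FreeGroup.of b * (FreeGroup.of a)⁻¹
    else if j = b then FreeGroup.of a else FreeGroup.of j

/-- The inverse of `artinHom a b` for `a ≠ b`. -/
def artinInv {α : Type} [DecidableEq α] (a b : α) : FreeGroup α →* FreeGroup α :=
  FreeGroup.lift fun j =>
    if j = a then FreeGroup.of b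
    else if j = b then (FreeGroup.of b)⁻¹ * FreeGroup.of a * FreeGroup.of b else FreeGroup.of j

/-- The automorphism `a ↦ a b a⁻¹`, `b ↦ a` of a free group fixing all the other generators. -/
def artinAut {α : Type} [DecidableEq α] (a b : α) (hab : a ≠ b) : MulAut (FreeGroup α) :=
  MonoidHom.toMulEquiv (artinHom a b) (artinInv a b)
    (by
      ext j
      by_cases h1 : j = a
      · subst h1; simp [artinHom, artinInv, hab.symm, mul_assoc]
      · by_cases h2 : j = b
        · subst h2; simp [artinHom, artinInv, h1]
        · simp [artinHom, artinInv, h1, h2])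
    (by
      ext j
      by_cases h1 : j = a
      · subst h1; simp [artinHom, artinInv, hab.symm]
      · by_cases h2 : j = b
        · subst h2; simp [artinHom, artinInv, h1, mul_assoc]
        · simp [artinHom, artinInv, h1, h2])

theorem artinAut_of {α : Type} [DecidableEq α] (a b : α) (hab : a ≠ b) (j : α) :
    artinAut a b hab (FreeGroup.of j) =
      if j = a then FreeGroup.of a * FreeGroup.of b * (FreeGroup.of a)⁻¹
      else if j = b then FreeGroup.of a else FreeGroup.of j := by
  simp [artinAut, artinHom]

theorem mulAut_free_ext {α : Type} {f g : MulAut (FreeGroup α)}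
    (h : ∀ j, f (FreeGroup.of j) = g (FreeGroup.of j)) : f = g := by
  have : f.toMonoidHom = g.toMonoidHom := FreeGroup.ext_hom _ _ h
  exact MulEquiv.toMonoidHom_injective this

theorem castSucc_ne_succ {n : ℕ} (i : Fin n) : i.castSucc ≠ i.succ := by
  intro h
  have := congrArg Fin.val h
  simp at this

theorem artinAut_comm {α : Type} [DecidableEq α] {a b c e : α} (h5 : a ≠ b) (h6 : c ≠ e)
    (h1 : a ≠ c) (h2 : a ≠ e) (h3 : b ≠ c) (h4 : b ≠ e) (l : α) :
    (artinAut a b h5 * artinAut c e h6) (FreeGroup.of l) =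
      (artinAut c e h6 * artinAut a b h5) (FreeGroup.of l) := by
  simp only [MulAut.mul_apply, artinAut_of]
  by_cases ha : l = a
  · subst ha
    simp [artinAut_of, h1, h2, h3, h4]
  by_cases hb : l = b
  · subst hb
    simp [artinAut_of, h1, h2, h3, h4, h5.symm]
  by_cases hc : l = c
  · subst hc
    simp [artinAut_of, h1.symm, h2.symm, h3.symm, h4.symm]
  by_cases he : l = e
  · subst he
    simp [artinAut_of, h1.symm, h2.symm, h3.symm, h4.symm, h6.symm]
  simp [artinAut_of, ha, hb, hc, he]

theorem artinAut_braid {α : Type} [DecidableEq α] {a b e : α} (h5 : a ≠ b) (h6 : b ≠ e)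
    (h2 : a ≠ e) (l : α) :
    (artinAut a b h5 * artinAut b e h6 * artinAut a b h5) (FreeGroup.of l) =
      (artinAut b e h6 * artinAut a b h5 * artinAut b e h6) (FreeGroup.of l) := by
  simp only [MulAut.mul_apply, artinAut_of]
  by_cases ha : l = a
  · subst ha
    simp [artinAut_of, h2, h5, h2.symm, h5.symm, h6.symm, mul_assoc]
  by_cases hb : l = b
  · subst hb
    simp [artinAut_of, h2, h5, h2.symm, h5.symm, h6.symm, mul_assoc]
  by_cases hc : l = e
  · subst hc
    simp [artinAut_of, h2, h5, h2.symm, h5.symm, h6.symm]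
  simp [artinAut_of, ha, hb, hc]

/-- Artin's action of the braid group on the free group `F_{n+1}`:
`s_i (x_i) = x_i x_{i+1} x_i⁻¹`, `s_i (x_{i+1}) = x_i`, `s_i (x_j) = x_j` otherwise. -/
def artinAction (n : ℕ) : BraidGroup n →* MulAut (FreeGroup (Fin (n + 1))) :=
  braidLift (fun i => artinAut i.castSucc i.succ (castSucc_ne_succ i))
    (by
      intro i j hij
      apply mulAut_free_ext
      intro l
      have h1 : i.castSucc ≠ j.castSucc := by rw [Ne, Fin.ext_iff]; simp; omega
      have h2 : i.castSucc ≠ j.succ := by rw [Ne, Fin.ext_iff]; simp; omega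
      have h3 : i.succ ≠ j.castSucc := by rw [Ne, Fin.ext_iff]; simp; omega
      have h4 : i.succ ≠ j.succ := by rw [Ne, Fin.ext_iff]; simp; omega
      have h5 := castSucc_ne_succ i
      have h6 := castSucc_ne_succ j
      exact artinAut_comm h5 h6 h1 h2 h3 h4 l)
    (by
      intro i j hij
      apply mulAut_free_ext
      intro l
      have h1 : j.castSucc = i.succ := by rw [Fin.ext_iff]; simp; omega
      have h2 : i.castSucc ≠ j.succ := by rw [Ne, Fin.ext_iff]; simp; omega
      have h5 := castSucc_ne_succ i
      have h6 := castSucc_ne_succ j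
      simp only [h1] at h6 ⊢
      exact artinAut_braid h5 h6 h2 l)

/-- The homomorphism `B_{n+1} → S_{n+1}` sending `s_i` to the transposition `(i, i+1)`. -/
def braidPerm (n : ℕ) : BraidGroup n →* Equiv.Perm (Fin (n + 1)) :=
  braidLift (fun i => Equiv.swap i.castSucc i.succ)
    (by
      intro i j hij
      have h1 : i.castSucc ≠ j.castSucc := by rw [Ne, Fin.ext_iff]; simp; omega
      have h2 : i.castSucc ≠ j.succ := by rw [Ne, Fin.ext_iff]; simp; omega
      have h3 : i.succ ≠ j.castSucc := by rw [Ne, Fin.ext_iff]; simp; omega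
      have h4 : i.succ ≠ j.succ := by rw [Ne, Fin.ext_iff]; simp; omega
      generalize i.castSucc = a at *
      generalize i.succ = b at *
      generalize j.castSucc = c at *
      generalize j.succ = e at *
      ext l
      simp only [Equiv.Perm.mul_apply, Equiv.swap_apply_def]
      congr 1
      split_ifs <;> simp_all)
    (by
      intro i j hij
      have h1 : j.castSucc = i.succ := by rw [Fin.ext_iff]; simp; omega
      have h2 : i.castSucc ≠ j.succ := by rw [Ne, Fin.ext_iff]; simp; omega
      have h5 := castSucc_ne_succ i
      have h6 := castSucc_ne_succ j
      simp only [h1] at h6 ⊢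
      generalize i.castSucc = a at *
      generalize i.succ = b at *
      generalize j.succ = e at *
      ext l
      simp only [Equiv.Perm.mul_apply, Equiv.swap_apply_def]
      congr 1
      split_ifs <;> simp_all)

/-- The pure braid group `P_{n+1}`. -/
abbrev pureBraidGroup (n : ℕ) : Subgroup (BraidGroup n) := (braidPerm n).ker

/-- Each braid carries each free generator to a conjugate of a free generator. -/
theorem artinAction_of (n : ℕ) (b : BraidGroup n) : ∀ j : Fin (n + 1),
    ∃ w : FreeGroup (Fin (n + 1)), artinAction n b (FreeGroup.of j) =
      w * FreeGroup.of (braidPerm n b j) * w⁻¹ := by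
  have hb : b ∈ Subgroup.closure (Set.range (PresentedGroup.of (rels := braidRels n))) := by
    rw [PresentedGroup.closure_range_of]; trivial
  induction hb using Subgroup.closure_induction with
  | mem x hx =>
    obtain ⟨i, rfl⟩ := hx
    intro j
    have e1 : artinAction n (PresentedGroup.of i) =
      artinAut i.castSucc i.succ (castSucc_ne_succ i) := by
      rw [artinAction, braidLift, PresentedGroup.toGroup.of]
    have e2 : braidPerm n (PresentedGroup.of i) =
      Equiv.swap i.castSucc i.succ := by
      rw [braidPerm, braidLift, PresentedGroup.toGroup.of]
    rw [e1, e2, artinAut_of]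
    by_cases h1 : j = i.castSucc
    · subst h1
      exact ⟨FreeGroup.of i.castSucc, by simp⟩
    · by_cases h2 : j = i.succ
      · subst h2
        exact ⟨1, by simp [(castSucc_ne_succ i).symm]⟩
      · exact ⟨1, by simp [h1, h2, Equiv.swap_apply_of_ne_of_ne h1 h2]⟩
  | one => intro j; exact ⟨1, by simp⟩
  | mul x y _ _ hx hy =>
    intro j
    obtain ⟨w, hw⟩ := hy j
    obtain ⟨u, hu⟩ := hx (braidPerm n y j)
    exact ⟨artinAction n x w * u, by
      rw [map_mul, MulAut.mul_apply, hw, map_mul, map_mul, map_inv, hu]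
      simp [mul_assoc]⟩
  | inv x _ hx =>
    intro j
    obtain ⟨w, hw⟩ := hx ((braidPerm n x)⁻¹ j)
    refine ⟨(artinAction n x⁻¹ w)⁻¹, ?_⟩
    have h2 := congrArg (artinAction n x⁻¹) hw
    rw [← MulAut.mul_apply, ← map_mul, inv_mul_cancel, map_one, MulAut.one_apply] at h2
    rw [← Equiv.Perm.mul_apply, mul_inv_cancel, Equiv.Perm.one_apply] at h2
    rw [map_inv (braidPerm n), h2]
    simp [mul_assoc]

/-- The action of the pure braid group on the free group. -/
def pureAction (n : ℕ) : pureBraidGroup n →* MulAut (FreeGroup (Fin (n + 1))) :=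
  (artinAction n).comp (pureBraidGroup n).subtype

theorem pureAction_of (n : ℕ) (p : pureBraidGroup n) (j : Fin (n + 1)) :
    ∃ w : FreeGroup (Fin (n + 1)), pureAction n p (FreeGroup.of j) =
      w * FreeGroup.of j * w⁻¹ := by
  obtain ⟨w, hw⟩ := artinAction_of n p j
  have hp : braidPerm n (p : BraidGroup n) = 1 := p.2
  rw [hp] at hw
  exact ⟨w, hw⟩

/-- The pure braid group acts trivially on every abelian quotient of the free group. -/
theorem pureAction_trivial {n : ℕ} {A : Type} [CommGroup A]
    (f : FreeGroup (Fin (n + 1)) →* A) (p : pureBraidGroup n) (x : FreeGroup (Fin (n + 1))) :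
    f (pureAction n p x) = f x := by
  have : f.comp (pureAction n p).toMonoidHom = f := by
    ext j
    obtain ⟨w, hw⟩ := pureAction_of n p j
    simp [hw]
  exact DFunLike.congr_fun this x

/-! ### The Gassner representation -/

/-- `F_{n+1}^{ab} = ℤ^{n+1}`, written multiplicatively. -/
abbrev Lattice (n : ℕ) : Type := Multiplicative (Fin (n + 1) → ℤ)

/-- The ring `R = ℤ[X_1^{±1}, …, X_{n+1}^{±1}]`, the group ring of `F_{n+1}^{ab}`. -/
abbrev Laurent (n : ℕ) : Type := MonoidAlgebra ℤ (Lattice n)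

/-- The class of the generator `x_i` in `F_{n+1}^{ab}`. -/
def latticeGen {n : ℕ} (i : Fin (n + 1)) : Lattice n := Multiplicative.ofAdd (Pi.single i 1)

/-- The variable `X_i` of the Laurent polynomial ring. -/
def varX {n : ℕ} (i : Fin (n + 1)) : Laurent n := MonoidAlgebra.of ℤ _ (latticeGen i)

/-- The action of `F_{n+1}^{ab}` on the additive group `R^{n+1}` by scalar multiplication. -/
def latticeAct (n : ℕ) : Lattice n →* MulAut (Multiplicative (Fin (n + 1) → Laurent n)) where
  toFun g :=
    { toFun := fun w => Multiplicative.ofAdd (MonoidAlgebra.of ℤ _ g • w.toAdd)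
      invFun := fun w => Multiplicative.ofAdd (MonoidAlgebra.of ℤ _ g⁻¹ • w.toAdd)
      left_inv := fun w => by
        simp only [toAdd_ofAdd, smul_smul, ← map_mul, inv_mul_cancel, map_one, one_smul, ofAdd_toAdd]
      right_inv := fun w => by
        simp only [toAdd_ofAdd, smul_smul, ← map_mul, mul_inv_cancel, map_one, one_smul, ofAdd_toAdd]
      map_mul' := fun w w' => by
        simp only [toAdd_mul, smul_add, ofAdd_add] }
  map_one' := by
    ext1 w
    change Multiplicative.ofAdd (MonoidAlgebra.of ℤ _ (1 : Lattice n) • w.toAdd) = w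
    rw [map_one, one_smul, ofAdd_toAdd]
  map_mul' g h := by
    ext1 w
    change Multiplicative.ofAdd (MonoidAlgebra.of ℤ _ (g * h) • w.toAdd) =
      Multiplicative.ofAdd (MonoidAlgebra.of ℤ _ g • MonoidAlgebra.of ℤ _ h • w.toAdd)
    rw [map_mul, smul_smul]

theorem latticeAct_apply {n : ℕ} (g : Lattice n)
    (w : Multiplicative (Fin (n + 1) → Laurent n)) :
    latticeAct n g w = Multiplicative.ofAdd (MonoidAlgebra.of ℤ _ g • w.toAdd) := rfl

/-- The homomorphism `F_{n+1} → R^{n+1} ⋊ F_{n+1}^{ab}`, `x_i ↦ (e_i, X_i)`. -/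
def magnus (n : ℕ) : FreeGroup (Fin (n + 1)) →*
    Multiplicative (Fin (n + 1) → Laurent n) ⋊[latticeAct n] Lattice n :=
  FreeGroup.lift fun i => ⟨Multiplicative.ofAdd (Pi.single i 1), latticeGen i⟩

/-- The vector component of the image of `x` in `R^{n+1} ⋊ F_{n+1}^{ab}`. -/
def vecPart {n : ℕ} (x : FreeGroup (Fin (n + 1))) : Fin (n + 1) → Laurent n :=
  (magnus n x).left.toAdd

/-- The class of `x` in `F_{n+1}^{ab}`, as a unit monomial of `R`. -/
def monoPart {n : ℕ} (x : FreeGroup (Fin (n + 1))) : Laurent n :=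
  MonoidAlgebra.of ℤ _ (magnus n x).right

theorem vecPart_of {n : ℕ} (i : Fin (n + 1)) :
    vecPart (FreeGroup.of i) = Pi.single i 1 := by
  simp [vecPart, magnus]

theorem monoPart_of {n : ℕ} (i : Fin (n + 1)) : monoPart (FreeGroup.of i) = varX i := by
  simp [monoPart, magnus, varX]

theorem vecPart_one {n : ℕ} : vecPart (1 : FreeGroup (Fin (n + 1))) = 0 := by
  simp [vecPart]

theorem monoPart_one {n : ℕ} : monoPart (1 : FreeGroup (Fin (n + 1))) = 1 := by
  simp only [monoPart, map_one, SemidirectProduct.one_right]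

theorem vecPart_mul {n : ℕ} (x y : FreeGroup (Fin (n + 1))) :
    vecPart (x * y) = vecPart x + monoPart x • vecPart y := by
  simp only [vecPart, monoPart, map_mul, SemidirectProduct.mul_left, latticeAct_apply, toAdd_mul,
    toAdd_ofAdd]

theorem monoPart_mul {n : ℕ} (x y : FreeGroup (Fin (n + 1))) :
    monoPart (x * y) = monoPart x * monoPart y := by
  simp only [monoPart, map_mul, SemidirectProduct.mul_right]

theorem monoPart_pure {n : ℕ} (p : pureBraidGroup n) (x : FreeGroup (Fin (n + 1))) :
    monoPart (pureAction n p x) = monoPart x := by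
  have := pureAction_trivial
    ((SemidirectProduct.rightHom (φ := latticeAct n)).comp (magnus n)) p x
  exact congrArg (MonoidAlgebra.of ℤ _) this

theorem monoPart_inv_mul {n : ℕ} (x : FreeGroup (Fin (n + 1))) :
    monoPart x⁻¹ * monoPart x = 1 := by
  rw [← monoPart_mul, inv_mul_cancel, monoPart_one]

theorem vecPart_inv {n : ℕ} (x : FreeGroup (Fin (n + 1))) :
    vecPart x⁻¹ = -(monoPart x⁻¹ • vecPart x) := by
  have h := vecPart_mul x⁻¹ x
  rw [inv_mul_cancel, vecPart_one] at h
  exact eq_neg_of_add_eq_zero_left h.symm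

theorem vecPart_conj {n : ℕ} (w : FreeGroup (Fin (n + 1))) (j : Fin (n + 1)) :
    vecPart (w * FreeGroup.of j * w⁻¹) =
      (1 - varX j) • vecPart w + monoPart w • Pi.single j 1 := by
  have h := monoPart_inv_mul w
  rw [vecPart_mul, vecPart_mul, vecPart_inv, monoPart_mul, vecPart_of, monoPart_of,
    smul_neg, smul_smul]
  have : monoPart w * varX j * monoPart w⁻¹ = varX j := by
    linear_combination (varX j) * h
  rw [this, sub_smul, one_smul]
  abel

/-- The matrix of the pure braid `p` on `R^{n+1}`: its `i`-th column is the vector component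
of `p (x_i)`, that is `p (x_i) = (p (e_i), X_i)`. -/
def gassnerMatrix {n : ℕ} (p : pureBraidGroup n) :
    Matrix (Fin (n + 1)) (Fin (n + 1)) (Laurent n) :=
  Matrix.of fun j i => vecPart (pureAction n p (FreeGroup.of i)) j

theorem gassnerMatrix_mulVec_single {n : ℕ} (p : pureBraidGroup n) (i : Fin (n + 1)) :
    (gassnerMatrix p).mulVec (Pi.single i 1) = vecPart (pureAction n p (FreeGroup.of i)) := by
  ext1 j
  simp [gassnerMatrix]

theorem gassnerMatrix_mulVec {n : ℕ} (p : pureBraidGroup n) (x : FreeGroup (Fin (n + 1))) :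
    (gassnerMatrix p).mulVec (vecPart x) = vecPart (pureAction n p x) := by
  induction x using FreeGroup.induction_on with
  | C1 => simp [vecPart_one]
  | of i => rw [vecPart_of, gassnerMatrix_mulVec_single]
  | inv_of i hi =>
    rw [map_inv, vecPart_inv, vecPart_inv, Matrix.mulVec_neg, Matrix.mulVec_smul, hi,
      ← map_inv, monoPart_pure]
  | mul x y hx hy =>
    rw [map_mul, vecPart_mul, vecPart_mul, Matrix.mulVec_add, Matrix.mulVec_smul, hx, hy,
      monoPart_pure]

/-- The Gassner representation `G_n(X) : P_{n+1} → GL_{n+1}(R)`. -/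
def gassner (n : ℕ) :
    pureBraidGroup n →* Matrix (Fin (n + 1)) (Fin (n + 1)) (Laurent n) where
  toFun := gassnerMatrix
  map_one' := by
    apply Matrix.ext_of_mulVec_single
    intro i
    rw [gassnerMatrix_mulVec_single, map_one, MulAut.one_apply, vecPart_of, Matrix.one_mulVec]
  map_mul' p q := by
    apply Matrix.ext_of_mulVec_single
    intro i
    rw [← Matrix.mulVec_mulVec, gassnerMatrix_mulVec_single, gassnerMatrix_mulVec_single,
      gassnerMatrix_mulVec, map_mul, MulAut.mul_apply]

/-! ### The reduced Gassner representation -/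

/-- The field of fractions `Ω` of the Laurent polynomial ring. -/
abbrev Omega (n : ℕ) : Type := FractionRing (Laurent n)

theorem one_sub_varX_ne_zero {n : ℕ} (i : Fin (n + 1)) : (1 : Laurent n) - varX i ≠ 0 := by
  intro h
  have h1 : MonoidAlgebra.of ℤ (Lattice n) 1 = MonoidAlgebra.of ℤ (Lattice n) (latticeGen i) := by
    rw [map_one]; exact sub_eq_zero.mp h
  have h2 := MonoidAlgebra.of_injective h1
  have h3 := congrFun (congrArg Multiplicative.toAdd h2) i
  simp [latticeGen] at h3

/-- The vector `v_i = (1 - X_i)⁻¹ e_i` of `Ω^{n+1}`. -/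
def vVec {n : ℕ} (i : Fin (n + 1)) : Fin (n + 1) → Omega n :=
  Pi.single i (algebraMap (Laurent n) (Omega n) (1 - varX i))⁻¹

/-- The vector `ε_i = v_i - v_{i+1}` of `Ω^{n+1}`. -/
def epsVec {n : ℕ} (i : Fin n) : Fin (n + 1) → Omega n := vVec i.castSucc - vVec i.succ

/-- The action of the pure braid group on `Ω^{n+1}`, extending the Gassner representation. -/
def gassnerOmega (n : ℕ) : Representation (Laurent n) (pureBraidGroup n)
    (Fin (n + 1) → Omega n) where
  toFun p := (Matrix.toLin' ((gassner n p).map (algebraMap (Laurent n) (Omega n)))).restrictScalars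
    (Laurent n)
  map_one' := by
    refine LinearMap.ext fun w => ?_
    simp
  map_mul' p q := by
    refine LinearMap.ext fun w => ?_
    simp [Matrix.map_mul]

/-- The `R`-submodule `W = ⊕ R ε_i` of `Ω^{n+1}`. -/
def reducedModule (n : ℕ) : Submodule (Laurent n) (Fin (n + 1) → Omega n) :=
  Submodule.span (Laurent n) (Set.range epsVec)

/-- The image in `Ω^{n+1}` of a vector of `R^{n+1}`. -/
def toOmega {n : ℕ} : (Fin (n + 1) → Laurent n) →ₗ[Laurent n] (Fin (n + 1) → Omega n) :=
  (Algebra.linearMap (Laurent n) (Omega n)).compLeft (Fin (n + 1))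

theorem algebraMap_ne_zero {n : ℕ} (i : Fin (n + 1)) :
    algebraMap (Laurent n) (Omega n) (1 - varX i) ≠ 0 := by
  rw [Ne, FaithfulSMul.algebraMap_eq_zero_iff]
  exact one_sub_varX_ne_zero i

theorem one_sub_smul_vVec {n : ℕ} (i : Fin (n + 1)) :
    (1 - varX i : Laurent n) • vVec i = toOmega (Pi.single i 1) := by
  have h : algebraMap (Laurent n) (Omega n) (1 - varX i) ≠ 0 := by
    exact algebraMap_ne_zero i
  ext1 j
  by_cases hj : j = i
  · subst hj
    simp only [vVec, toOmega, Pi.smul_apply, Pi.single_eq_same, Algebra.smul_def]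
    rw [mul_inv_cancel₀ h]
    simp
  · simp [vVec, toOmega, hj]

theorem gassnerOmega_toOmega {n : ℕ} (p : pureBraidGroup n) (w : Fin (n + 1) → Laurent n) :
    gassnerOmega n p (toOmega w) = toOmega ((gassnerMatrix p).mulVec w) := by
  ext1 j
  simp [gassnerOmega, toOmega, gassner, Matrix.mulVec, dotProduct]

theorem omega_smul_cancel {n : ℕ} (i : Fin (n + 1)) {a b : Fin (n + 1) → Omega n}
    (h : (1 - varX i : Laurent n) • a = (1 - varX i : Laurent n) • b) : a = b := by
  have h0 : algebraMap (Laurent n) (Omega n) (1 - varX i) ≠ 0 := by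
    exact algebraMap_ne_zero i
  ext1 j
  have := congrFun h j
  simp only [Pi.smul_apply, Algebra.smul_def] at this
  exact mul_left_cancel₀ h0 this

theorem gassnerOmega_vVec {n : ℕ} (p : pureBraidGroup n) (i : Fin (n + 1)) :
    ∃ w : FreeGroup (Fin (n + 1)),
      gassnerOmega n p (vVec i) = toOmega (vecPart w) + monoPart w • vVec i := by
  obtain ⟨w, hw⟩ := pureAction_of n p i
  refine ⟨w, omega_smul_cancel i ?_⟩
  rw [← map_smul, one_sub_smul_vVec, gassnerOmega_toOmega, gassnerMatrix_mulVec_single, hw,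
    vecPart_conj, map_add, map_smul, map_smul, smul_add, ← one_sub_smul_vVec, smul_comm]

theorem vVec_sub_mem {n : ℕ} (i : Fin (n + 1)) : vVec i - vVec 0 ∈ reducedModule n := by
  induction i using Fin.induction with
  | zero => simp
  | succ i ih =>
    have h : epsVec i ∈ reducedModule n := Submodule.subset_span ⟨i, rfl⟩
    have := sub_mem ih h
    simpa [epsVec] using this

theorem vecPart_mem {n : ℕ} (x : FreeGroup (Fin (n + 1))) :
    toOmega (vecPart x) - (1 - monoPart x) • vVec 0 ∈ reducedModule n := by
  induction x using FreeGroup.induction_on with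
  | C1 => simp [vecPart_one, monoPart_one]
  | of i =>
    rw [vecPart_of, monoPart_of, ← one_sub_smul_vVec, ← smul_sub]
    exact Submodule.smul_mem _ _ (vVec_sub_mem i)
  | inv_of i hi =>
    have h := Submodule.smul_mem _ (-monoPart (FreeGroup.of i)⁻¹) hi
    have e := monoPart_inv_mul (FreeGroup.of i)
    rw [vecPart_inv, map_neg, map_smul]
    convert! h using 1
    rw [smul_sub, smul_smul, neg_smul]
    congr 2
    linear_combination -e
  | mul x y hx hy =>
    have h := add_mem hx (Submodule.smul_mem _ (monoPart x) hy)
    rw [vecPart_mul, monoPart_mul, map_add, map_smul]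
    convert! h using 1
    module

theorem reducedModule_stable {n : ℕ} (p : pureBraidGroup n) {w : Fin (n + 1) → Omega n}
    (hw : w ∈ reducedModule n) : gassnerOmega n p w ∈ reducedModule n := by
  have key : ∀ i : Fin (n + 1), gassnerOmega n p (vVec i) - vVec 0 ∈ reducedModule n := by
    intro i
    obtain ⟨w, hw⟩ := gassnerOmega_vVec p i
    have h := add_mem (vecPart_mem w) (Submodule.smul_mem _ (monoPart w) (vVec_sub_mem i))
    rw [hw]
    convert! h using 1
    module
  have hle : reducedModule n ≤ (reducedModule n).comap (gassnerOmega n p) := by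
    refine Submodule.span_le.mpr ?_
    rintro _ ⟨i, rfl⟩
    have h := sub_mem (key i.castSucc) (key i.succ)
    simpa [epsVec] using h
  exact hle hw

/-- The reduced Gassner representation of the pure braid group on the `R`-module `W`. -/
def reducedGassner (n : ℕ) :
    Representation (Laurent n) (pureBraidGroup n) (reducedModule n) where
  toFun p := (gassnerOmega n p).restrict fun _ hw => reducedModule_stable p hw
  map_one' := by
    ext1 w
    apply Subtype.ext
    simp [LinearMap.restrict_apply]
  map_mul' p q := by
    ext1 w
    apply Subtype.ext
    simp [LinearMap.restrict_apply]

theorem epsVec_linearIndependent (n : ℕ) :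
    LinearIndependent (Laurent n) (epsVec : Fin n → Fin (n + 1) → Omega n) := by
  rw [Fintype.linearIndependent_iff]
  intro c hc
  have hne : ∀ j : Fin (n + 1), (algebraMap (Laurent n) (Omega n) (1 - varX j))⁻¹ ≠ 0 := by
    intro j
    apply inv_ne_zero
    exact algebraMap_ne_zero j
  suffices h : ∀ m : ℕ, ∀ i : Fin n, (i : ℕ) = m → c i = 0 from fun i => h i i rfl
  intro m
  induction m with
  | zero =>
    intro i hi
    have h := congrFun hc i.castSucc
    rw [Finset.sum_apply, Finset.sum_eq_single i] at h
    · simp only [epsVec, vVec, Pi.smul_apply, Pi.sub_apply, Pi.single_eq_same,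
        Pi.single_eq_of_ne (castSucc_ne_succ i), sub_zero, Pi.zero_apply, Algebra.smul_def] at h
      simpa using (mul_eq_zero.mp h).resolve_right (hne _)
    · intro j _ hj
      have h1 : i.castSucc ≠ j.castSucc := by simpa using hj.symm
      have h2 : i.castSucc ≠ j.succ := by rw [Ne, Fin.ext_iff]; simp; omega
      simp [epsVec, vVec, h1, h2]
    · simp
  | succ m ih =>
    intro i hi
    have h := congrFun hc i.castSucc
    rw [Finset.sum_apply, Finset.sum_eq_single i] at h
    · simp only [epsVec, vVec, Pi.smul_apply, Pi.sub_apply, Pi.single_eq_same,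
        Pi.single_eq_of_ne (castSucc_ne_succ i), sub_zero, Pi.zero_apply, Algebra.smul_def] at h
      simpa using (mul_eq_zero.mp h).resolve_right (hne _)
    · intro j _ hj
      by_cases hjm : (j : ℕ) = m
      · simp [ih j hjm]
      have h1 : i.castSucc ≠ j.castSucc := by simpa using hj.symm
      have h2 : i.castSucc ≠ j.succ := by rw [Ne, Fin.ext_iff]; simp; omega
      simp [epsVec, vVec, h1, h2]
    · simp

/-- The basis `ε_1, …, ε_n` of `W`. -/
def epsBasis (n : ℕ) : Module.Basis (Fin n) (Laurent n) (reducedModule n) :=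
  Module.Basis.span (epsVec_linearIndependent n)

/-- The reduced Gassner representation `g_n(X) : P_{n+1} → GL_n(R)` in the basis `ε_i`. -/
def reducedGassnerMatrix (n : ℕ) :
    pureBraidGroup n →* Matrix (Fin n) (Fin n) (Laurent n) :=
  (LinearMap.toMatrixAlgEquiv (epsBasis n)).toMonoidHom.comp (reducedGassner n)

/-- The ring homomorphism `R → A` with `X_i ↦ t_i`. -/
def specialise {n : ℕ} {A : Type} [CommRing A] (t : Fin (n + 1) → Aˣ) : Laurent n →+* A :=
  (MonoidAlgebra.lift ℤ A (Lattice n)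
    { toFun := fun m => ((∏ i, t i ^ m.toAdd i : Aˣ) : A)
      map_one' := by simp
      map_mul' := fun a b => by
        simp only [toAdd_mul, Pi.add_apply, zpow_add, Finset.prod_mul_distrib, Units.val_mul] }
    : Laurent n →ₐ[ℤ] A).toRingHom

/-- The reduced Gassner representation specialised at `X_i ↦ t_i`, on `A^n = ⊕ A ε_i`. -/
def reducedGassnerAt {n : ℕ} {A : Type} [CommRing A] (t : Fin (n + 1) → Aˣ) :
    Representation A (pureBraidGroup n) (Fin n → A) :=
  (Matrix.toLinAlgEquiv' : Matrix (Fin n) (Fin n) A ≃ₐ[A] _).toMonoidHom.comp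
    ((specialise t).mapMatrix.toMonoidHom.comp (reducedGassnerMatrix n))

instance (e : ℕ) [NeZero e] : IsCyclotomicExtension {e} ℚ (CyclotomicField e ℚ) :=
  CyclotomicField.isCyclotomicExtension e ℚ

/-- A primitive `e`-th root of unity `ω_e` in the cyclotomic field `E_e = ℚ(ω_e)`. -/
def omegaUnit (e : ℕ) [NeZero e] : (CyclotomicField e ℚ)ˣ :=
  Units.mk0 (IsCyclotomicExtension.zeta e ℚ (CyclotomicField e ℚ))
    ((IsCyclotomicExtension.zeta_spec e ℚ (CyclotomicField e ℚ)).ne_zero (NeZero.ne e))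

/-- The representation `g_n(k, e)`: the reduced Gassner representation specialised at
`X_i ↦ ω_e ^ {k_i}`, viewed as a representation over `ℚ` on `E_e^n`. -/
def gassnerAtRoot {n : ℕ} (k : Fin (n + 1) → ℤ) (e : ℕ) [NeZero e] :
    Representation ℚ (pureBraidGroup n) (Fin n → CyclotomicField e ℚ) where
  toFun p := (reducedGassnerAt (fun i => omegaUnit e ^ k i) p).toAddMonoidHom.toRatLinearMap
  map_one' := by rw [map_one]; rfl
  map_mul' p q := by rw [map_mul]; rfl

/-! ### The ring `R_d` -/

/-- The polynomial `1 + q + ⋯ + q^{d-1}`. -/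
def normPoly (d : ℕ) : ℚ[X] := ∑ i ∈ Finset.range d, X ^ i

/-- The ring `R_d = ℚ[q] / (1 + q + ⋯ + q^{d-1})`. -/
abbrev RingRd (d : ℕ) : Type := ℚ[X] ⧸ Ideal.span {normPoly d}

/-- The class `q` in `R_d`. -/
def qElt (d : ℕ) : RingRd d := Ideal.Quotient.mk _ X

theorem qElt_pow (d : ℕ) : qElt d ^ d = 1 := by
  have h : qElt d ^ d - 1 = 0 := by
    rw [qElt, ← map_pow, ← map_one (Ideal.Quotient.mk _), ← map_sub, Ideal.Quotient.eq_zero_iff_mem,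
      Ideal.mem_span_singleton]
    exact ⟨X - 1, (geom_sum_mul X d).symm⟩
  exact sub_eq_zero.mp h

/-- The class `q` as a unit of `R_d`. -/
def qUnit (d : ℕ) [NeZero d] : (RingRd d)ˣ :=
  Units.ofPowEqOne (qElt d) d (qElt_pow d) (NeZero.ne d)

/-! ### The homology of the cyclic covering -/

/-- The first rational homology `K^{ab} ⊗ ℚ` of a group. -/
abbrev H1Q (K : Type) [Group K] : Type := TensorProduct ℤ ℚ (Additive (Abelianization K))

/-- The action of endomorphisms of a group on its first rational homology. -/
def H1Qmap (K : Type) [Group K] : Monoid.End K →* Module.End ℚ (H1Q K) where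
  toFun f := (MonoidHom.toAdditive (Abelianization.map f)).toIntLinearMap.baseChange ℚ
  map_one' := by
    have : (MonoidHom.toAdditive (Abelianization.map (1 : Monoid.End K))).toIntLinearMap =
        LinearMap.id := by
      ext1 a
      exact DFunLike.congr_fun (Abelianization.map_id (G := K)) a.toMul
    rw [this, LinearMap.baseChange_id]
    rfl
  map_mul' f g := by
    have : (MonoidHom.toAdditive (Abelianization.map (f * g))).toIntLinearMap =
        (MonoidHom.toAdditive (Abelianization.map f)).toIntLinearMap ∘ₗ
          (MonoidHom.toAdditive (Abelianization.map g)).toIntLinearMap := by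
      ext1 a
      exact (DFunLike.congr_fun (Abelianization.map_comp (f := g) f) a.toMul).symm
    rw [this, LinearMap.baseChange_comp]
    rfl

/-- An automorphism, as an endomorphism. -/
def autToEnd (K : Type) [Group K] : MulAut K →* Monoid.End K where
  toFun f := f.toMonoidHom
  map_one' := rfl
  map_mul' _ _ := rfl

/-- The homomorphism `F_{n+1} → ℤ/d`, `x_i ↦ q^{k_i}`. -/
def chi {n : ℕ} (k : Fin (n + 1) → ℤ) (d : ℕ) :
    FreeGroup (Fin (n + 1)) →* Multiplicative (ZMod d) :=
  FreeGroup.lift fun i => Multiplicative.ofAdd (k i : ZMod d)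

/-- The group `K_0(k, d)`. -/
abbrev K0 {n : ℕ} (k : Fin (n + 1) → ℤ) (d : ℕ) : Subgroup (FreeGroup (Fin (n + 1))) :=
  (chi k d).ker

/-- The space `V_0 = K_0(k, d)^{ab} ⊗ ℚ`. -/
abbrev V0 {n : ℕ} (k : Fin (n + 1) → ℤ) (d : ℕ) : Type := H1Q (K0 k d)

/-- The action of `F_{n+1}` on `V_0` induced by conjugation. -/
def conjAction {n : ℕ} (k : Fin (n + 1) → ℤ) (d : ℕ) :
    Representation ℚ (FreeGroup (Fin (n + 1))) (V0 k d) :=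
  (H1Qmap (K0 k d)).comp
    ((autToEnd (K0 k d)).comp MulAut.conjNormal)

theorem conjAction_of_mem {n : ℕ} (k : Fin (n + 1) → ℤ) (d : ℕ)
    (x : FreeGroup (Fin (n + 1))) (hx : x ∈ K0 k d) : conjAction k d x = 1 := by
  have h : (MonoidHom.toAdditive (Abelianization.map
      ((autToEnd (K0 k d)) (MulAut.conjNormal x)))).toIntLinearMap =
      LinearMap.id := by
    ext1 a
    obtain ⟨y, hy⟩ := QuotientGroup.mk_surjective a.toMul
    have ha : a = Additive.ofMul (Abelianization.of y) := congrArg Additive.ofMul hy.symm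
    subst ha
    change Additive.ofMul (Abelianization.of (MulAut.conjNormal x y)) =
      Additive.ofMul (Abelianization.of y)
    have e : MulAut.conjNormal x y = (⟨x, hx⟩ : K0 k d) * y * (⟨x, hx⟩ : K0 k d)⁻¹ := by
      apply Subtype.ext
      simp [MulAut.conjNormal_apply]
    rw [e]
    simp
  change ((MonoidHom.toAdditive (Abelianization.map
      ((autToEnd (K0 k d)) (MulAut.conjNormal x)))).toIntLinearMap).baseChange ℚ = 1
  rw [h, LinearMap.baseChange_id]
  rfl

/-- The conjugation action on `V_0` only depends on the image in `ℤ/d`. -/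
theorem conjAction_congr {n : ℕ} (k : Fin (n + 1) → ℤ) (d : ℕ)
    {x y : FreeGroup (Fin (n + 1))} (h : chi k d x = chi k d y) :
    conjAction k d x = conjAction k d y := by
  have hm : x * y⁻¹ ∈ K0 k d := by
    rw [MonoidHom.mem_ker, map_mul, map_inv, h, mul_inv_cancel]
  have e := conjAction_of_mem k d _ hm
  have : x = x * y⁻¹ * y := by group
  rw [this, map_mul, e, one_mul]

/-- An element `ξ` of `F_{n+1}` with image `q` in `ℤ/d` (when `k_1` is prime to `d`). -/
def xi {n : ℕ} (k : Fin (n + 1) → ℤ) (d : ℕ) : FreeGroup (Fin (n + 1)) :=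
  FreeGroup.of 0 ^ ((k 0 : ZMod d)⁻¹).val

theorem chi_xi {n : ℕ} (k : Fin (n + 1) → ℤ) (d : ℕ) [NeZero d]
    (hk : IsCoprime (k 0) (d : ℤ)) : chi k d (xi k d) = Multiplicative.ofAdd 1 := by
  have hu : IsUnit (k 0 : ZMod d) := by
    obtain ⟨a, b, hab⟩ := hk
    have := congrArg (Int.cast : ℤ → ZMod d) hab
    push_cast at this
    rw [ZMod.natCast_self, mul_zero, add_zero] at this
    exact IsUnit.of_mul_eq_one_right _ this
  rw [xi, map_pow, chi, FreeGroup.lift_apply_of, ← ofAdd_nsmul, nsmul_eq_mul, ZMod.natCast_val,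
    ZMod.cast_id', id, ZMod.inv_mul_of_unit _ hu]

/-- The action of the generator `q` of `ℤ/d` on `V_0`: conjugation by any element with image `q`
(see `conjAction_congr` and `chi_xi`). -/
def qAct {n : ℕ} (k : Fin (n + 1) → ℤ) (d : ℕ) : Module.End ℚ (V0 k d) :=
  conjAction k d (xi k d)

theorem qAct_pow {n : ℕ} (k : Fin (n + 1) → ℤ) (d : ℕ) : qAct k d ^ d = 1 := by
  rw [qAct, ← map_pow]
  apply conjAction_of_mem
  rw [MonoidHom.mem_ker, map_pow]
  apply Multiplicative.toAdd.injective
  rw [toAdd_pow, nsmul_eq_mul, ZMod.natCast_self, zero_mul, toAdd_one]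

/-- The submodule `(1 + q + ⋯ + q^{d-1}) V_0`. -/
def normRange {n : ℕ} (k : Fin (n + 1) → ℤ) (d : ℕ) : Submodule ℚ (V0 k d) :=
  LinearMap.range (aeval (qAct k d) (normPoly d))

/-- The quotient `V_0^{ni} = V_0 / (1 + q + ⋯ + q^{d-1}) V_0`. -/
def V0ni {n : ℕ} (k : Fin (n + 1) → ℤ) (d : ℕ) : Type := V0 k d ⧸ normRange k d

instance {n : ℕ} (k : Fin (n + 1) → ℤ) (d : ℕ) : AddCommGroup (V0ni k d) :=
  inferInstanceAs (AddCommGroup (V0 k d ⧸ normRange k d))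

instance {n : ℕ} (k : Fin (n + 1) → ℤ) (d : ℕ) : Module ℚ (V0ni k d) :=
  inferInstanceAs (Module ℚ (V0 k d ⧸ normRange k d))

/-- The projection `V_0 → V_0^{ni}`. -/
def V0ni.mk {n : ℕ} (k : Fin (n + 1) → ℤ) (d : ℕ) : V0 k d →ₗ[ℚ] V0ni k d :=
  (normRange k d).mkQ

theorem V0ni.mk_surjective {n : ℕ} (k : Fin (n + 1) → ℤ) (d : ℕ) :
    Function.Surjective (V0ni.mk k d) := (normRange k d).mkQ_surjective

/-- An endomorphism of `V_0` that commutes with `q` acts on `V_0^{ni}`. -/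
def V0ni.map {n : ℕ} (k : Fin (n + 1) → ℤ) (d : ℕ) (f : Module.End ℚ (V0 k d))
    (hf : Commute f (qAct k d)) : Module.End ℚ (V0ni k d) :=
  (normRange k d).mapQ (normRange k d) f (by
    rintro _ ⟨v, rfl⟩
    have hc : Commute f (aeval (qAct k d) (normPoly d)) := by
      rw [normPoly, map_sum]
      refine Commute.sum_right _ _ _ fun i _ => ?_
      rw [map_pow, aeval_X]
      exact hf.pow_right i
    exact ⟨f v, (DFunLike.congr_fun hc.eq v).symm⟩)

theorem V0ni.map_mk {n : ℕ} (k : Fin (n + 1) → ℤ) (d : ℕ) (f : Module.End ℚ (V0 k d))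
    (hf : Commute f (qAct k d)) (v : V0 k d) :
    V0ni.map k d f hf (V0ni.mk k d v) = V0ni.mk k d (f v) := rfl

/-- The action of `q` on `V_0^{ni}`. -/
def qActNi {n : ℕ} (k : Fin (n + 1) → ℤ) (d : ℕ) : Module.End ℚ (V0ni k d) :=
  V0ni.map k d (qAct k d) (Commute.refl _)

theorem aeval_qActNi_mk {n : ℕ} (k : Fin (n + 1) → ℤ) (d : ℕ) (f : ℚ[X]) (v : V0 k d) :
    aeval (qActNi k d) f (V0ni.mk k d v) = V0ni.mk k d (aeval (qAct k d) f v) := by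
  induction f using Polynomial.induction_on' generalizing v with
  | add f g hf hg => simp [hf, hg]
  | monomial m a =>
    have h : ∀ v, (qActNi k d ^ m) (V0ni.mk k d v) = V0ni.mk k d ((qAct k d ^ m) v) := by
      induction m with
      | zero => intro v; simp
      | succ m ih =>
        intro v
        rw [pow_succ, pow_succ, Module.End.mul_apply, Module.End.mul_apply, qActNi, V0ni.map_mk,
          ← qActNi, ih]
    simp [aeval_monomial, h]

theorem aeval_normPoly {n : ℕ} (k : Fin (n + 1) → ℤ) (d : ℕ) :
    aeval (qActNi k d) (normPoly d) = 0 := by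
  ext1 v
  obtain ⟨v, rfl⟩ := V0ni.mk_surjective k d v
  rw [aeval_qActNi_mk]
  exact (Submodule.Quotient.mk_eq_zero _).mpr ⟨v, rfl⟩

/-- The homomorphism `R_d → End (V_0^{ni})`, with `q` acting through `ℤ/d`. -/
def ringRdAct {n : ℕ} (k : Fin (n + 1) → ℤ) (d : ℕ) :
    RingRd d →ₐ[ℚ] Module.End ℚ (V0ni k d) :=
  Ideal.Quotient.liftₐ _ (aeval (qActNi k d)) (by
    intro a ha
    obtain ⟨b, rfl⟩ := Ideal.mem_span_singleton.mp ha
    rw [map_mul, aeval_normPoly, zero_mul])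

/-- The `R_d`-module structure of `V_0^{ni}`. -/
instance {n : ℕ} (k : Fin (n + 1) → ℤ) (d : ℕ) : Module (RingRd d) (V0ni k d) :=
  Module.compHom (V0ni k d) (ringRdAct k d).toRingHom

theorem ringRd_smul_def {n : ℕ} (k : Fin (n + 1) → ℤ) (d : ℕ) (r : RingRd d) (v : V0ni k d) :
    r • v = ringRdAct k d r v := rfl

theorem qElt_smul {n : ℕ} (k : Fin (n + 1) → ℤ) (d : ℕ) (v : V0ni k d) :
    qElt d • v = qActNi k d v := by
  change aeval (qActNi k d) X v = _
  rw [aeval_X]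

instance {n : ℕ} (k : Fin (n + 1) → ℤ) (d : ℕ) : IsScalarTower ℚ (RingRd d) (V0ni k d) where
  smul_assoc a r v := by
    rw [ringRd_smul_def, ringRd_smul_def, map_smul, LinearMap.smul_apply]

/-- The action of the pure braid group on `K_0(k, d)`. -/
def pureActionK0 {n : ℕ} (k : Fin (n + 1) → ℤ) (d : ℕ) :
    pureBraidGroup n →* Monoid.End (K0 k d) where
  toFun p := ((pureAction n p).toMonoidHom.comp (K0 k d).subtype).codRestrict (K0 k d) (by
    intro x
    change chi k d (pureAction n p x) = 1
    rw [pureAction_trivial]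
    exact x.2)
  map_one' := by
    refine MonoidHom.ext fun x => Subtype.ext ?_
    change pureAction n 1 x = x
    rw [map_one, MulAut.one_apply]
  map_mul' p q := by
    refine MonoidHom.ext fun x => Subtype.ext ?_
    change pureAction n (p * q) x = pureAction n p (pureAction n q x)
    rw [map_mul, MulAut.mul_apply]

theorem pureActionK0_coe {n : ℕ} (k : Fin (n + 1) → ℤ) (d : ℕ) (p : pureBraidGroup n)
    (x : K0 k d) : (pureActionK0 k d p x : FreeGroup (Fin (n + 1))) = pureAction n p x := rfl

/-- The action of the pure braid group on `V_0`. -/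
def pureActionV0 {n : ℕ} (k : Fin (n + 1) → ℤ) (d : ℕ) :
    Representation ℚ (pureBraidGroup n) (V0 k d) :=
  (H1Qmap (K0 k d)).comp (pureActionK0 k d)

theorem pureActionV0_conj {n : ℕ} (k : Fin (n + 1) → ℤ) (d : ℕ) (p : pureBraidGroup n)
    (x : FreeGroup (Fin (n + 1))) :
    Commute (pureActionV0 k d p) (conjAction k d x) := by
  have h1 : pureActionV0 k d p * conjAction k d x =
      conjAction k d (pureAction n p x) * pureActionV0 k d p := by
    simp only [pureActionV0, conjAction, MonoidHom.comp_apply]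
    rw [← map_mul, ← map_mul]
    congr 1
    refine MonoidHom.ext fun y => Subtype.ext ?_
    change pureAction n p (x * y * x⁻¹) =
      pureAction n p x * pureAction n p y * (pureAction n p x)⁻¹
    rw [map_mul, map_mul, map_inv]
  rw [Commute, SemiconjBy, h1, conjAction_congr k d (pureAction_trivial (chi k d) p x)]

theorem pureActionV0_comm {n : ℕ} (k : Fin (n + 1) → ℤ) (d : ℕ) (p : pureBraidGroup n) :
    Commute (pureActionV0 k d p) (qAct k d) := pureActionV0_conj k d p _

/-- The representation of the pure braid group on `V_0^{ni}`, over `ℚ`. -/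
def homologyRepQ {n : ℕ} (k : Fin (n + 1) → ℤ) (d : ℕ) :
    Representation ℚ (pureBraidGroup n) (V0ni k d) where
  toFun p := V0ni.map k d (pureActionV0 k d p) (pureActionV0_comm k d p)
  map_one' := by
    refine LinearMap.ext fun v => ?_
    obtain ⟨v, rfl⟩ := V0ni.mk_surjective k d v
    rw [V0ni.map_mk, map_one, Module.End.one_apply, Module.End.one_apply]
  map_mul' p q := by
    refine LinearMap.ext fun v => ?_
    obtain ⟨v, rfl⟩ := V0ni.mk_surjective k d v
    rw [Module.End.mul_apply, V0ni.map_mk, V0ni.map_mk, V0ni.map_mk, map_mul, Module.End.mul_apply]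

theorem homologyRepQ_mk {n : ℕ} (k : Fin (n + 1) → ℤ) (d : ℕ) (p : pureBraidGroup n)
    (v : V0 k d) :
    homologyRepQ k d p (V0ni.mk k d v) = V0ni.mk k d (pureActionV0 k d p v) := rfl

theorem homologyRepQ_smul {n : ℕ} (k : Fin (n + 1) → ℤ) (d : ℕ) (p : pureBraidGroup n)
    (r : RingRd d) (v : V0ni k d) : homologyRepQ k d p (r • v) = r • homologyRepQ k d p v := by
  obtain ⟨f, rfl⟩ := Ideal.Quotient.mk_surjective r
  obtain ⟨v, rfl⟩ := V0ni.mk_surjective k d v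
  have hc : Commute (pureActionV0 k d p) (aeval (qAct k d) f) := by
    induction f using Polynomial.induction_on' with
    | add f g hf hg => rw [map_add]; exact hf.add_right hg
    | monomial m a =>
      rw [aeval_monomial]
      exact (Algebra.commute_algebraMap_right a _).mul_right
        ((pureActionV0_comm k d p).pow_right m)
  have hs : ∀ u : V0 k d, (Ideal.Quotient.mk (Ideal.span {normPoly d}) f) • V0ni.mk k d u =
      V0ni.mk k d (aeval (qAct k d) f u) := fun u => aeval_qActNi_mk k d f u
  rw [hs, homologyRepQ_mk, homologyRepQ_mk, hs]
  exact congrArg (V0ni.mk k d) (DFunLike.congr_fun hc.eq v)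

/-- The representation of the pure braid group on `V_0^{ni}`, over `R_d`. -/
def homologyRep {n : ℕ} (k : Fin (n + 1) → ℤ) (d : ℕ) :
    Representation (RingRd d) (pureBraidGroup n) (V0ni k d) where
  toFun p :=
    { toFun := homologyRepQ k d p
      map_add' := map_add (homologyRepQ k d p)
      map_smul' := homologyRepQ_smul k d p }
  map_one' := LinearMap.ext fun v => DFunLike.congr_fun (map_one (homologyRepQ k d)) v
  map_mul' p q := LinearMap.ext fun v => DFunLike.congr_fun (map_mul (homologyRepQ k d) p q) v

/-- The divisors `e ≥ 2` of `d`. -/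
abbrev NontrivDivisor (d : ℕ) : Type := {e : ℕ // e ∣ d ∧ 2 ≤ e}

instance {d : ℕ} (e : NontrivDivisor d) : NeZero (e : ℕ) := ⟨by have := e.2.2; omega⟩

end PureBraid

end

noncomputable section

namespace PureBraid

/-! ### The ring `R_d` and its cyclotomic quotients -/

/-! The bridge between the two sides is a crossed homomorphism. The vector part of `magnus`
satisfies c(xy) = c(x) + X^x c(y). Subtracting the principal crossed homomorphism of v_1 (index 0 in
Lean) makes it land in W, where it vanishes at x_1. After specialising X_i to q^{k_i}, the twist
becomes the character x ↦ q^{χ(x)}, which is trivial on K_0(k,d). On K_0 the crossed homomorphism is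
therefore a genuine homomorphism to R_d^n. Conjugation by an element over q turns into
multiplication by q. A pure braid p commutes with the crossed homomorphism up to a principal one,
which dies on K_0. This gives an R_d-linear, P_{n+1}-equivariant map V_0^{ni} → R_d^n (`toGassner`).

The map is bijective because 1 - q, and hence each 1 - q^{k_i}, is a unit of R_d. Surjectivity: the
crossed homomorphism takes x_i to (1 - q^{k_i})(v_i - v_1), so every v_i - v_1, and with it every
ε_i, is in the image. Injectivity: a power ξ of x_1 lies over q, and powers of ξ in K_0 have class
zero in V_0^{ni}, since 1 - q kills them. Hence x ↦ [x ξ^{-χ(x)}] is a well-defined crossed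
homomorphism F_{n+1} → V_0^{ni} (`crossedNi`). It vanishes at x_1, so its values at the other n
generators span V_0^{ni}. The composite R_d^n → V_0^{ni} → R_d^n is a surjective endomorphism of a
finitely generated module, hence injective.

The decomposition over ℚ is the Chinese remainder theorem: 1 + q + ⋯ + q^{d-1} is the product of the
pairwise coprime cyclotomic polynomials Φ_e with e ∣ d, e ≥ 2, so R_d is the product of the fields
E_e. -/

theorem qUnit_val (d : ℕ) [NeZero d] : (qUnit d : RingRd d) = qElt d := rfl

theorem qUnit_pow (d : ℕ) [NeZero d] : qUnit d ^ d = 1 :=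
  Units.ext (by rw [Units.val_pow_eq_pow_val, qUnit_val, qElt_pow, Units.val_one])

/-- The norm polynomial takes the value d at 1, so it is congruent to d modulo X - 1. In R_d it is
zero, so 1 - q divides d, which is invertible over ℚ. -/
theorem isUnit_one_sub_qElt (d : ℕ) [NeZero d] : IsUnit (1 - qElt d) := by
  have hd : IsUnit (algebraMap ℚ (RingRd d) d) :=
    (IsUnit.mk0 (d : ℚ) (Nat.cast_ne_zero.mpr (NeZero.ne d))).map _
  refine isUnit_of_dvd_unit ?_ hd
  have h1 : (X - C 1 : ℚ[X]) ∣ normPoly d - C ((normPoly d).eval 1) := X_sub_C_dvd_sub_C_eval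
  have h2 : (normPoly d).eval 1 = d := by simp [normPoly, eval_finsetSum]
  obtain ⟨g, hg⟩ := h1
  refine ⟨Ideal.Quotient.mk _ g, ?_⟩
  have h3 := congrArg (Ideal.Quotient.mk (Ideal.span {normPoly d})) hg
  have h4 : Ideal.Quotient.mk (Ideal.span {normPoly d}) (normPoly d) = 0 :=
    Ideal.Quotient.eq_zero_iff_mem.mpr (Ideal.mem_span_singleton_self _)
  rw [h2, map_sub, h4, map_mul, map_sub, map_one, map_one] at h3
  have h5 : algebraMap ℚ (RingRd d) d = Ideal.Quotient.mk _ (C (d : ℚ)) := rfl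
  rw [h5, qElt]
  linear_combination -h3

/-- The homomorphism `ℤ/d → R_dˣ` sending the generator to `q`. -/
def qPow (d : ℕ) [NeZero d] : Multiplicative (ZMod d) →* (RingRd d)ˣ :=
  AddMonoidHom.toMultiplicativeLeft (ZMod.lift d
    ⟨(zmultiplesHom (Additive (RingRd d)ˣ)) (Additive.ofMul (qUnit d)), by
      rw [zmultiplesHom_apply, natCast_zsmul, ← ofMul_pow, qUnit_pow, ofMul_one]⟩)

theorem qPow_intCast (d : ℕ) [NeZero d] (m : ℤ) :
    qPow d (Multiplicative.ofAdd (m : ZMod d)) = qUnit d ^ m := by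
  simp [qPow]

/-- For m prime to d, q is itself a power of q^m, so 1 - q^m divides the unit 1 - q. -/
theorem isUnit_one_sub_qUnit_zpow (d : ℕ) [NeZero d] {m : ℤ} (hm : IsCoprime m (d : ℤ)) :
    IsUnit (1 - ((qUnit d ^ m : (RingRd d)ˣ) : RingRd d)) := by
  refine isUnit_of_dvd_unit ?_ (isUnit_one_sub_qElt d)
  obtain ⟨a, b, hab⟩ := hm
  -- The residue of the Bézout coefficient a is a natural exponent inverse to m modulo d.
  have h : ((a : ZMod d).val * m : ZMod d) = 1 := by
    have := congrArg (Int.cast : ℤ → ZMod d) hab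
    push_cast at this
    rw [ZMod.natCast_self, mul_zero, add_zero] at this
    rw [ZMod.natCast_val, ZMod.cast_id', id, this]
  have h2 : (qUnit d ^ m) ^ (a : ZMod d).val = qUnit d := by
    rw [← zpow_natCast, ← zpow_mul, ← qPow_intCast]
    push_cast
    rw [mul_comm, h, ← Int.cast_one, qPow_intCast, zpow_one]
  rw [← qUnit_val]
  nth_rewrite 2 [← h2]
  rw [Units.val_pow_eq_pow_val]
  exact one_sub_dvd_one_sub_pow _ _

/-- The homomorphism `R_d → E_e`, `q ↦ ω_e`, for a divisor `e ≥ 2` of `d`. -/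
def toCyclotomic {d : ℕ} (e : NontrivDivisor d) : RingRd d →ₐ[ℚ] CyclotomicField (e : ℕ) ℚ :=
  Ideal.Quotient.liftₐ _ (aeval ((omegaUnit (e : ℕ) : (CyclotomicField (e : ℕ) ℚ)ˣ) :
      CyclotomicField (e : ℕ) ℚ)) (by
    intro a ha
    obtain ⟨b, rfl⟩ := Ideal.mem_span_singleton.mp ha
    have hz := IsCyclotomicExtension.zeta_spec (e : ℕ) ℚ (CyclotomicField (e : ℕ) ℚ)
    have h1 : aeval (IsCyclotomicExtension.zeta (e : ℕ) ℚ (CyclotomicField (e : ℕ) ℚ))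
        (normPoly d) = 0 := by
      -- The geometric sum times ω_e - 1 is ω_e^d - 1 = 0, and e ≥ 2 makes ω_e - 1 nonzero.
      have h2 := congrArg (aeval (IsCyclotomicExtension.zeta (e : ℕ) ℚ
        (CyclotomicField (e : ℕ) ℚ))) (geom_sum_mul (X : ℚ[X]) d)
      rw [map_mul, map_sub, map_sub, map_pow, aeval_X, map_one,
        (hz.pow_eq_one_iff_dvd d).mpr e.2.1, sub_self] at h2
      refine (mul_eq_zero.mp h2).resolve_right (sub_ne_zero.mpr (hz.ne_one ?_))
      have := e.2.2
      omega
    rw [map_mul, omegaUnit, Units.val_mk0, h1, zero_mul])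

theorem toCyclotomic_mk {d : ℕ} (e : NontrivDivisor d) (f : ℚ[X]) :
    toCyclotomic e (Ideal.Quotient.mk _ f) =
      aeval (IsCyclotomicExtension.zeta (e : ℕ) ℚ (CyclotomicField (e : ℕ) ℚ)) f := rfl

theorem toCyclotomic_qElt {d : ℕ} (e : NontrivDivisor d) :
    toCyclotomic e (qElt d) = (omegaUnit (e : ℕ) : (CyclotomicField (e : ℕ) ℚ)ˣ) := by
  rw [qElt, toCyclotomic_mk, aeval_X]
  rfl

theorem aeval_zeta_eq_zero_iff (e : ℕ) [NeZero e] (f : ℚ[X]) :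
    aeval (IsCyclotomicExtension.zeta e ℚ (CyclotomicField e ℚ)) f = 0 ↔ cyclotomic e ℚ ∣ f := by
  rw [cyclotomic_eq_minpoly_rat (IsCyclotomicExtension.zeta_spec e ℚ (CyclotomicField e ℚ))
    (NeZero.pos e), minpoly.dvd_iff]

/-- A polynomial vanishing at every ω_e is divisible by each Φ_e. These are pairwise coprime over ℚ,
and their product over the divisors e ≠ 1 of d is the norm polynomial. -/
theorem toCyclotomic_jointly_injective {d : ℕ} [NeZero d] {r : RingRd d}
    (h : ∀ e : NontrivDivisor d, toCyclotomic e r = 0) : r = 0 := by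
  obtain ⟨f, rfl⟩ := Ideal.Quotient.mk_surjective r
  rw [Ideal.Quotient.eq_zero_iff_mem, Ideal.mem_span_singleton, normPoly,
    ← prod_cyclotomic_eq_geom_sum (NeZero.pos d)]
  refine Finset.prod_dvd_of_coprime (fun a _ b _ hab => cyclotomic.isCoprime_rat hab) ?_
  intro e he
  rw [Finset.mem_erase, Nat.mem_divisors] at he
  have h0 : e ≠ 0 := fun h => he.2.2 (by rw [h] at he; exact zero_dvd_iff.mp he.2.1)
  have : NeZero e := ⟨h0⟩
  exact (aeval_zeta_eq_zero_iff e f).mp (h ⟨e, he.2.1, by omega⟩)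

instance (d : ℕ) [NeZero d] : Finite (NontrivDivisor d) :=
  Finite.of_injective (fun e => (⟨e, Nat.mem_divisors.mpr ⟨e.2.1, NeZero.ne d⟩⟩ : d.divisors))
    fun _ _ h => Subtype.ext (congrArg (fun x : d.divisors => (x : ℕ)) h)

/-- Each component is a polynomial in ω_e. The Chinese remainder theorem for the ideals (Φ_e) merges
these polynomials into one. -/
theorem toCyclotomic_jointly_surjective {d : ℕ} [NeZero d]
    (z : ∀ e : NontrivDivisor d, CyclotomicField (e : ℕ) ℚ) :
    ∃ r : RingRd d, ∀ e, toCyclotomic e r = z e := by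
  have hs : ∀ e : NontrivDivisor d, ∃ f : ℚ[X],
      aeval (IsCyclotomicExtension.zeta (e : ℕ) ℚ (CyclotomicField (e : ℕ) ℚ)) f = z e := by
    intro e
    have := IsCyclotomicExtension.adjoin_primitive_root_eq_top (A := ℚ)
      (IsCyclotomicExtension.zeta_spec (e : ℕ) ℚ (CyclotomicField (e : ℕ) ℚ))
    have hz : z e ∈ Algebra.adjoin ℚ
        {IsCyclotomicExtension.zeta (e : ℕ) ℚ (CyclotomicField (e : ℕ) ℚ)} := by
      rw [this]; trivial
    rw [Algebra.adjoin_singleton_eq_range_aeval] at hz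
    exact hz
  choose f hf using hs
  obtain ⟨g, hg⟩ := Ideal.exists_forall_sub_mem_ideal
    (I := fun e : NontrivDivisor d => Ideal.span {cyclotomic (e : ℕ) ℚ})
    (fun a b hab => (Ideal.isCoprime_span_singleton_iff _ _).mpr
      (cyclotomic.isCoprime_rat fun h => hab (Subtype.ext h))) f
  refine ⟨Ideal.Quotient.mk _ g, fun e => ?_⟩
  have := (aeval_zeta_eq_zero_iff (e : ℕ) _).mpr (Ideal.mem_span_singleton.mp (hg e))
  rw [map_sub, sub_eq_zero] at this
  rw [toCyclotomic_mk, this, hf]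

theorem nontrivial_ringRd {d : ℕ} (hd : 2 ≤ d) : Nontrivial (RingRd d) :=
  (toCyclotomic (⟨d, dvd_rfl, hd⟩ : NontrivDivisor d)).toRingHom.domain_nontrivial

/-! ### Specialisations -/

theorem specialise_of {n : ℕ} {A : Type} [CommRing A] (t : Fin (n + 1) → Aˣ) (m : Lattice n) :
    specialise t (MonoidAlgebra.of ℤ _ m) = ((∏ i, t i ^ m.toAdd i : Aˣ) : A) :=
  MonoidAlgebra.lift_of _ _

theorem specialise_varX {n : ℕ} {A : Type} [CommRing A] (t : Fin (n + 1) → Aˣ)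
    (i : Fin (n + 1)) : specialise t (varX i) = t i := by
  rw [varX, specialise_of, Finset.prod_eq_single i]
  · simp [latticeGen]
  · intro j _ hj
    simp [latticeGen, hj]
  · simp

theorem specialise_map {n : ℕ} {A B : Type} [CommRing A] [CommRing B] (f : A →+* B)
    (t : Fin (n + 1) → Aˣ) :
    f.comp (specialise t) = specialise (n := n) fun i => Units.map f.toMonoidHom (t i) := by
  refine MonoidAlgebra.ringHom_ext' (RingHom.ext_int _ _) ?_
  refine MonoidHom.ext fun m => ?_
  change f (specialise t (MonoidAlgebra.of ℤ _ m)) = specialise _ (MonoidAlgebra.of ℤ _ m)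
  rw [specialise_of, specialise_of]
  simp only [← map_zpow, ← map_prod]
  rfl

theorem reducedGassnerAt_apply {n : ℕ} {A : Type} [CommRing A] (t : Fin (n + 1) → Aˣ)
    (p : pureBraidGroup n) (w : Fin n → A) :
    reducedGassnerAt t p w = ((reducedGassnerMatrix n p).map (specialise t)).mulVec w := rfl

/-- Base change of specialisations, used to pass from q^{k_i} in R_d to ω_e^{k_i} in E_e. -/
theorem reducedGassnerAt_map {n : ℕ} {A B : Type} [CommRing A] [CommRing B] (f : A →+* B)
    (t : Fin (n + 1) → Aˣ) (p : pureBraidGroup n) (w : Fin n → A) :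
    f ∘ reducedGassnerAt t p w =
      reducedGassnerAt (fun i => Units.map f.toMonoidHom (t i)) p (f ∘ w) := by
  ext j
  rw [reducedGassnerAt_apply, reducedGassnerAt_apply, Function.comp_apply, RingHom.map_mulVec,
    Matrix.map_map, ← specialise_map]
  rfl

/-! ### The crossed homomorphism `F_{n+1} → W` and its specialisations -/

/-- The crossed homomorphism `F_{n+1} → W` obtained from `vecPart` by subtracting the principal
crossed homomorphism of `v_1`. -/
def reducedVec {n : ℕ} (x : FreeGroup (Fin (n + 1))) : reducedModule n :=
  ⟨toOmega (vecPart x) - (1 - monoPart x) • vVec 0, vecPart_mem x⟩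

/-- The principal term (1 - X^x) v_1 satisfies the same twisted product rule as `vecPart`, so their
difference does too. -/
theorem reducedVec_mul {n : ℕ} (x y : FreeGroup (Fin (n + 1))) :
    reducedVec (x * y) = reducedVec x + monoPart x • reducedVec y := by
  apply Subtype.ext
  simp only [reducedVec, Submodule.coe_add, Submodule.coe_smul]
  rw [vecPart_mul, monoPart_mul, map_add, map_smul]
  module

/-- The vector `v_i - v_1` of `W`. -/
def vSub {n : ℕ} (i : Fin (n + 1)) : reducedModule n := ⟨vVec i - vVec 0, vVec_sub_mem i⟩

theorem reducedVec_of {n : ℕ} (i : Fin (n + 1)) :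
    reducedVec (FreeGroup.of i) = (1 - varX i) • vSub i := by
  apply Subtype.ext
  simp only [reducedVec, vSub, Submodule.coe_smul]
  rw [vecPart_of, monoPart_of, ← one_sub_smul_vVec, smul_sub]

theorem vSub_zero {n : ℕ} : vSub (0 : Fin (n + 1)) = 0 :=
  Subtype.ext (sub_self _)

theorem epsBasis_eq {n : ℕ} (i : Fin n) : epsBasis n i = vSub i.castSucc - vSub i.succ := by
  apply Subtype.ext
  have h : ((epsBasis n i : reducedModule n) : Fin (n + 1) → Omega n) = epsVec i :=
    congrArg Subtype.val (Module.Basis.span_apply (epsVec_linearIndependent n) i)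
  rw [h]
  simp [vSub, epsVec]

/-- The braid p commutes with `vecPart`, and the only defect comes from moving the base vector v_1.
Writing p(v_1) = c(w) + X^w v_1 shows that the defect is the principal crossed homomorphism of
`reducedVec w`, with one w for all x. -/
theorem reducedGassner_reducedVec {n : ℕ} (p : pureBraidGroup n) : ∃ u : reducedModule n,
    ∀ x, reducedGassner n p (reducedVec x) =
      reducedVec (pureAction n p x) - (1 - monoPart x) • u := by
  obtain ⟨w, hw⟩ := gassnerOmega_vVec p 0
  refine ⟨reducedVec w, fun x => Subtype.ext ?_⟩
  change gassnerOmega n p (toOmega (vecPart x) - (1 - monoPart x) • vVec 0) =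
    toOmega (vecPart (pureAction n p x)) - (1 - monoPart (pureAction n p x)) • vVec 0 -
      (1 - monoPart x) • (toOmega (vecPart w) - (1 - monoPart w) • vVec 0)
  rw [map_sub, map_smul, gassnerOmega_toOmega, gassnerMatrix_mulVec, monoPart_pure, hw]
  module

/-- The specialised coordinates of a vector of `W` in the basis `ε_1, …, ε_n`. -/
def coordAt {n : ℕ} {A : Type} [CommRing A] (t : Fin (n + 1) → Aˣ) :
    reducedModule n →ₛₗ[specialise t] (Fin n → A) where
  toFun w i := specialise t ((epsBasis n).repr w i)
  map_add' w w' := by ext i; simp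
  map_smul' r w := by ext i; simp

theorem coordAt_apply {n : ℕ} {A : Type} [CommRing A] (t : Fin (n + 1) → Aˣ)
    (w : reducedModule n) (i : Fin n) :
    coordAt t w i = specialise t ((epsBasis n).repr w i) := rfl

theorem coordAt_epsBasis {n : ℕ} {A : Type} [CommRing A] (t : Fin (n + 1) → Aˣ) (i : Fin n) :
    coordAt t (epsBasis n i) = Pi.single i 1 := by
  ext j
  rw [coordAt_apply, Module.Basis.repr_self, Finsupp.single_apply, Pi.single_apply]
  split_ifs <;> simp_all

theorem coordAt_reducedGassner {n : ℕ} {A : Type} [CommRing A] (t : Fin (n + 1) → Aˣ)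
    (p : pureBraidGroup n) (w : reducedModule n) :
    coordAt t (reducedGassner n p w) = reducedGassnerAt t p (coordAt t w) := by
  ext j
  have h : (reducedGassnerMatrix n p).mulVec ((epsBasis n).repr w) =
      (epsBasis n).repr (reducedGassner n p w) :=
    LinearMap.toMatrix_mulVec_repr (epsBasis n) (epsBasis n) (reducedGassner n p) w
  rw [reducedGassnerAt_apply, coordAt_apply, ← h, RingHom.map_mulVec]
  rfl

/-- The crossed homomorphism `F_{n+1} → A^n` obtained by specialising `reducedVec`. -/
def crossedAt {n : ℕ} {A : Type} [CommRing A] (t : Fin (n + 1) → Aˣ)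
    (x : FreeGroup (Fin (n + 1))) : Fin n → A := coordAt t (reducedVec x)

theorem crossedAt_mul {n : ℕ} {A : Type} [CommRing A] (t : Fin (n + 1) → Aˣ)
    (x y : FreeGroup (Fin (n + 1))) :
    crossedAt t (x * y) = crossedAt t x + specialise t (monoPart x) • crossedAt t y := by
  rw [crossedAt, reducedVec_mul, map_add, map_smulₛₗ]
  rfl

theorem crossedAt_one {n : ℕ} {A : Type} [CommRing A] (t : Fin (n + 1) → Aˣ) :
    crossedAt t 1 = 0 := by
  have h := crossedAt_mul t 1 1
  rw [monoPart_one, map_one, one_smul, mul_one] at h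
  simpa using h

theorem crossedAt_of {n : ℕ} {A : Type} [CommRing A] (t : Fin (n + 1) → Aˣ) (i : Fin (n + 1)) :
    crossedAt t (FreeGroup.of i) = (1 - t i : A) • coordAt t (vSub i) := by
  rw [crossedAt, reducedVec_of, map_smulₛₗ, map_sub, map_one, specialise_varX]

/-- This is the effect of taking v_1 as base vector. It matches the vanishing of `crossedNi` on
powers of ξ. -/
theorem crossedAt_of_zero_pow {n : ℕ} {A : Type} [CommRing A] (t : Fin (n + 1) → Aˣ) (m : ℕ) :
    crossedAt t (FreeGroup.of 0 ^ m) = 0 := by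
  induction m with
  | zero => rw [pow_zero, crossedAt_one]
  | succ m ih => rw [pow_succ, crossedAt_mul, ih, crossedAt_of, vSub_zero]; simp

theorem crossedAt_inv {n : ℕ} {A : Type} [CommRing A] (t : Fin (n + 1) → Aˣ)
    (x : FreeGroup (Fin (n + 1))) :
    crossedAt t x + specialise t (monoPart x) • crossedAt t x⁻¹ = 0 := by
  rw [← crossedAt_mul, mul_inv_cancel, crossedAt_one]

/-- As x has trivial character, the contributions of w and w⁻¹ cancel. -/
theorem crossedAt_conj {n : ℕ} {A : Type} [CommRing A] (t : Fin (n + 1) → Aˣ)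
    (w x : FreeGroup (Fin (n + 1))) (hx : specialise t (monoPart x) = 1) :
    crossedAt t (w * x * w⁻¹) = specialise t (monoPart w) • crossedAt t x := by
  have h := crossedAt_inv t w
  rw [crossedAt_mul, crossedAt_mul, monoPart_mul, map_mul, hx, mul_one, add_right_comm, h, zero_add]

/-- The principal defect carries the factor 1 - X^x, which specialises to zero here. Equivariance is
thus exact on K_0 though it can fail on F_{n+1}. -/
theorem crossedAt_pureAction {n : ℕ} {A : Type} [CommRing A] (t : Fin (n + 1) → Aˣ)
    (p : pureBraidGroup n) (x : FreeGroup (Fin (n + 1))) (hx : specialise t (monoPart x) = 1) :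
    crossedAt t (pureAction n p x) = reducedGassnerAt t p (crossedAt t x) := by
  obtain ⟨u, hu⟩ := reducedGassner_reducedVec p
  rw [crossedAt, crossedAt, ← coordAt_reducedGassner, hu, map_sub, map_smulₛₗ, map_sub, map_one, hx,
    sub_self, zero_smul, sub_zero]

/-- The character `x_i ↦ t_i` of the free group, read off from the monomial part. -/
def monoAt {n : ℕ} {A : Type} [CommRing A] (t : Fin (n + 1) → Aˣ) :
    FreeGroup (Fin (n + 1)) →* A where
  toFun x := specialise t (monoPart x)
  map_one' := by rw [monoPart_one, map_one]
  map_mul' x y := by rw [monoPart_mul, map_mul]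

theorem specialise_monoPart {n : ℕ} (k : Fin (n + 1) → ℤ) (d : ℕ) [NeZero d]
    (x : FreeGroup (Fin (n + 1))) :
    specialise (fun i => qUnit d ^ k i) (monoPart x) = qPow d (chi k d x) := by
  have h : monoAt (fun i => qUnit d ^ k i) =
      (Units.coeHom (RingRd d)).comp ((qPow d).comp (chi k d)) := by
    ext i
    change specialise (fun i => qUnit d ^ k i) (monoPart (FreeGroup.of i)) =
      qPow d (chi k d (FreeGroup.of i))
    rw [monoPart_of, specialise_varX, chi, FreeGroup.lift_apply_of, qPow_intCast]
  exact DFunLike.congr_fun h x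

theorem specialise_monoPart_of_mem {n : ℕ} (k : Fin (n + 1) → ℤ) (d : ℕ) [NeZero d]
    {x : FreeGroup (Fin (n + 1))} (hx : x ∈ K0 k d) :
    specialise (fun i => qUnit d ^ k i) (monoPart x) = 1 := by
  rw [specialise_monoPart, MonoidHom.mem_ker.mp hx, map_one, Units.val_one]

/-! ### Generators of `V_0^{ni}` -/

/-- The class in `V_0` of an element of `K_0(k, d)`. -/
def classV0 {n : ℕ} (k : Fin (n + 1) → ℤ) (d : ℕ) (x : K0 k d) : V0 k d :=
  (1 : ℚ) ⊗ₜ[ℤ] Additive.ofMul (Abelianization.of x)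

theorem V0_induction {n : ℕ} {k : Fin (n + 1) → ℤ} {d : ℕ} {P : V0 k d → Prop}
    (h0 : P 0) (hadd : ∀ v w, P v → P w → P (v + w))
    (hclass : ∀ (a : ℚ) (x : K0 k d), P (a • classV0 k d x)) (v : V0 k d) : P v := by
  induction v using TensorProduct.induction_on with
  | zero => exact h0
  | add v w hv hw => exact hadd v w hv hw
  | tmul a y =>
    obtain ⟨x, hx⟩ := QuotientGroup.mk_surjective y.toMul
    have hy : y = Additive.ofMul (Abelianization.of x) := congrArg Additive.ofMul hx.symm
    have := hclass a x
    rwa [classV0, TensorProduct.smul_tmul', smul_eq_mul, mul_one, ← hy] at this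

/-- The class in `V_0^{ni}` of an element of `K_0(k, d)`. -/
def classNi {n : ℕ} (k : Fin (n + 1) → ℤ) (d : ℕ) (x : K0 k d) : V0ni k d :=
  V0ni.mk k d (classV0 k d x)

theorem classNi_mul {n : ℕ} (k : Fin (n + 1) → ℤ) (d : ℕ) (x y : K0 k d) :
    classNi k d (x * y) = classNi k d x + classNi k d y := by
  rw [classNi, classV0, map_mul, ofMul_mul, TensorProduct.tmul_add, map_add]
  rfl

theorem mk_qAct_pow {n : ℕ} (k : Fin (n + 1) → ℤ) (d : ℕ) (m : ℕ) (v : V0 k d) :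
    V0ni.mk k d ((qAct k d ^ m) v) = qElt d ^ m • V0ni.mk k d v := by
  have h := aeval_qActNi_mk k d (X ^ m) v
  rw [map_pow, map_pow, aeval_X, aeval_X] at h
  rw [← h, qElt, ← map_pow]
  change _ = aeval (qActNi k d) (X ^ m) _
  rw [map_pow, aeval_X]

theorem chi_eq_ofAdd_val {n : ℕ} (k : Fin (n + 1) → ℤ) (d : ℕ) [NeZero d]
    (x : FreeGroup (Fin (n + 1))) :
    chi k d x = Multiplicative.ofAdd ((((chi k d x).toAdd.val : ℕ) : ℤ) : ZMod d) := by
  rw [Int.cast_natCast, ZMod.natCast_val, ZMod.cast_id', id, ofAdd_toAdd]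

/-- Conjugation depends only on the image in ℤ/d, so w may be replaced by a power of ξ, for which
the action is a power of q by definition. -/
theorem mk_conjAction {n : ℕ} (k : Fin (n + 1) → ℤ) (d : ℕ) [NeZero d]
    (hk : IsCoprime (k 0) (d : ℤ)) (w : FreeGroup (Fin (n + 1))) (v : V0 k d) :
    V0ni.mk k d (conjAction k d w v) =
      ((qPow d (chi k d w) : (RingRd d)ˣ) : RingRd d) • V0ni.mk k d v := by
  have h1 := chi_eq_ofAdd_val k d w
  have h2 : chi k d w = chi k d (xi k d ^ (chi k d w).toAdd.val) := by
    rw [map_pow, chi_xi k d hk, ← ofAdd_nsmul, nsmul_eq_mul, mul_one]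
    exact_mod_cast h1
  rw [conjAction_congr k d h2, map_pow, ← qAct, mk_qAct_pow]
  nth_rewrite 2 [h1]
  rw [qPow_intCast, zpow_natCast, Units.val_pow_eq_pow_val, qUnit_val]

theorem classNi_conj {n : ℕ} (k : Fin (n + 1) → ℤ) (d : ℕ) [NeZero d]
    (hk : IsCoprime (k 0) (d : ℤ)) (w : FreeGroup (Fin (n + 1))) (x : K0 k d) :
    classNi k d (MulAut.conjNormal w x) =
      ((qPow d (chi k d w) : (RingRd d)ˣ) : RingRd d) • classNi k d x :=
  mk_conjAction k d hk w (classV0 k d x)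

/-- Conjugation by ξ fixes x and multiplies its class by q, so the unit 1 - q annihilates the class.
-/
theorem classNi_eq_zero {n : ℕ} (k : Fin (n + 1) → ℤ) (d : ℕ) [NeZero d]
    (hk : IsCoprime (k 0) (d : ℤ)) (x : K0 k d) (hx : Commute (xi k d) x) :
    classNi k d x = 0 := by
  have h := classNi_conj k d hk (xi k d) x
  have h1 : MulAut.conjNormal (xi k d) x = x := by
    apply Subtype.ext
    rw [MulAut.conjNormal_apply, hx.eq, mul_inv_cancel_right]
  have h2 : qPow d (Multiplicative.ofAdd 1) = qUnit d := by
    have := qPow_intCast d 1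
    rwa [Int.cast_one, zpow_one] at this
  rw [h1, chi_xi k d hk, h2, qUnit_val] at h
  have h3 : (1 - qElt d) • classNi k d x = 0 := by rw [sub_smul, one_smul, ← h, sub_self]
  exact (isUnit_one_sub_qElt d).smul_eq_zero.mp h3

/-! ### The crossed homomorphism into V_0^{ni} -/

theorem mul_xi_zpow_mem {n : ℕ} {k : Fin (n + 1) → ℤ} {d : ℕ} [NeZero d]
    (hk : IsCoprime (k 0) (d : ℤ)) {x : FreeGroup (Fin (n + 1))} {a : ℤ}
    (h : chi k d x = Multiplicative.ofAdd (a : ZMod d)) : x * xi k d ^ (-a) ∈ K0 k d := by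
  rw [MonoidHom.mem_ker, map_mul, map_zpow, chi_xi k d hk, h, ← ofAdd_zsmul, ← ofAdd_add]
  simp

/-- The crossed homomorphism `F_{n+1} → V_0^{ni}` that vanishes at `ξ` and extends the class map
of `K_0(k, d)`. -/
def crossedNi {n : ℕ} (k : Fin (n + 1) → ℤ) (d : ℕ) [NeZero d] (hk : IsCoprime (k 0) (d : ℤ))
    (x : FreeGroup (Fin (n + 1))) : V0ni k d :=
  classNi k d ⟨_, mul_xi_zpow_mem hk (chi_eq_ofAdd_val k d x)⟩

/-- Any integer lift a of χ(x) may be used, because two lifts change the element of K_0 by a power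
of ξ, whose class is zero. This freedom is needed for products, where the sum of two reduced
residues need not be reduced. -/
theorem crossedNi_eq {n : ℕ} {k : Fin (n + 1) → ℤ} {d : ℕ} [NeZero d]
    (hk : IsCoprime (k 0) (d : ℤ)) {x : FreeGroup (Fin (n + 1))} {a : ℤ}
    (h : chi k d x = Multiplicative.ofAdd (a : ZMod d)) :
    crossedNi k d hk x = classNi k d ⟨_, mul_xi_zpow_mem hk h⟩ := by
  set b : ℤ := (((chi k d x).toAdd.val : ℕ) : ℤ) with hb
  have hm := mul_xi_zpow_mem hk h
  have hm' : x * xi k d ^ (-b) ∈ K0 k d := mul_xi_zpow_mem hk (chi_eq_ofAdd_val k d x)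
  have hy : xi k d ^ (a - b) ∈ K0 k d := by
    have := mul_mem (inv_mem hm) hm'
    rwa [mul_inv_rev, mul_assoc, inv_mul_cancel_left, ← zpow_neg, neg_neg, ← zpow_add,
      ← sub_eq_add_neg] at this
  have e : (⟨_, hm'⟩ : K0 k d) = ⟨_, hm⟩ * ⟨_, hy⟩ := by
    apply Subtype.ext
    change x * xi k d ^ (-b) = x * xi k d ^ (-a) * xi k d ^ (a - b)
    rw [mul_assoc, ← zpow_add]
    congr 2
    ring
  change classNi k d ⟨_, hm'⟩ = _
  rw [e, classNi_mul, classNi_eq_zero k d hk ⟨_, hy⟩ (Commute.self_zpow _ _), add_zero]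

theorem crossedNi_mul {n : ℕ} {k : Fin (n + 1) → ℤ} {d : ℕ} [NeZero d]
    (hk : IsCoprime (k 0) (d : ℤ)) (x y : FreeGroup (Fin (n + 1))) :
    crossedNi k d hk (x * y) = crossedNi k d hk x +
      ((qPow d (chi k d x) : (RingRd d)ˣ) : RingRd d) • crossedNi k d hk y := by
  set a : ℤ := (((chi k d x).toAdd.val : ℕ) : ℤ) with ha
  set b : ℤ := (((chi k d y).toAdd.val : ℕ) : ℤ) with hb
  have hx : chi k d x = Multiplicative.ofAdd (a : ZMod d) := chi_eq_ofAdd_val k d x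
  have hy : chi k d y = Multiplicative.ofAdd (b : ZMod d) := chi_eq_ofAdd_val k d y
  have hxy : chi k d (x * y) = Multiplicative.ofAdd ((a + b : ℤ) : ZMod d) := by
    rw [map_mul, hx, hy, ← ofAdd_add, Int.cast_add]
  have hw : chi k d x = chi k d (xi k d ^ a) := by
    rw [hx, map_zpow, chi_xi k d hk, ← ofAdd_zsmul]
    simp
  rw [crossedNi_eq hk hxy, crossedNi_eq hk hx, crossedNi_eq hk hy, hw, ← classNi_conj k d hk,
    ← classNi_mul]
  -- The identity behind the product rule is xy ξ^{-(a+b)} = (x ξ^{-a}) · ξ^a (y ξ^{-b}) ξ^{-a}.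
  congr 1
  apply Subtype.ext
  change x * y * xi k d ^ (-(a + b)) =
    x * xi k d ^ (-a) * (MulAut.conjNormal (xi k d ^ a) (⟨_, mul_xi_zpow_mem hk hy⟩ : K0 k d) :)
  rw [MulAut.conjNormal_apply]
  group

theorem crossedNi_of_mem {n : ℕ} {k : Fin (n + 1) → ℤ} {d : ℕ} [NeZero d]
    (hk : IsCoprime (k 0) (d : ℤ)) (x : K0 k d) :
    crossedNi k d hk x = classNi k d x := by
  have h : chi k d x = Multiplicative.ofAdd ((0 : ℤ) : ZMod d) := by
    rw [MonoidHom.mem_ker.mp x.2, Int.cast_zero, ofAdd_zero]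
  rw [crossedNi_eq hk h]
  congr 1
  apply Subtype.ext
  simp

/-- As ξ is a power of x_1, the representative x_1 ξ^{-a} commutes with ξ. This brings the number of
generators of V_0^{ni} down from n + 1 to n. -/
theorem crossedNi_of_zero {n : ℕ} {k : Fin (n + 1) → ℤ} {d : ℕ} [NeZero d]
    (hk : IsCoprime (k 0) (d : ℤ)) : crossedNi k d hk (FreeGroup.of 0) = 0 := by
  refine classNi_eq_zero k d hk _ ?_
  have h : Commute (xi k d) (FreeGroup.of 0) := (Commute.refl _).pow_left _
  exact h.mul_right (Commute.self_zpow _ _)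

theorem crossedNi_mem_span {n : ℕ} {k : Fin (n + 1) → ℤ} {d : ℕ} [NeZero d]
    (hk : IsCoprime (k 0) (d : ℤ)) (x : FreeGroup (Fin (n + 1))) :
    crossedNi k d hk x ∈ Submodule.span (RingRd d)
      (Set.range fun i : Fin n => crossedNi k d hk (FreeGroup.of i.succ)) := by
  have h1 : crossedNi k d hk 1 = 0 := by
    have := crossedNi_mul hk 1 1
    rw [map_one, map_one, Units.val_one, one_smul, mul_one] at this
    simpa using this
  induction x using FreeGroup.induction_on with
  | C1 => rw [h1]; exact zero_mem _
  | of i =>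
    induction i using Fin.cases with
    | zero => rw [crossedNi_of_zero]; exact zero_mem _
    | succ i => exact Submodule.subset_span ⟨i, rfl⟩
  | inv_of i hi =>
    have h := crossedNi_mul hk (FreeGroup.of i)⁻¹ (FreeGroup.of i)
    rw [inv_mul_cancel, h1] at h
    rw [eq_neg_of_add_eq_zero_left h.symm]
    exact neg_mem (Submodule.smul_mem _ _ hi)
  | mul x y hx hy =>
    rw [crossedNi_mul]
    exact add_mem hx (Submodule.smul_mem _ _ hy)

theorem span_crossedNi {n : ℕ} {k : Fin (n + 1) → ℤ} {d : ℕ} [NeZero d]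
    (hk : IsCoprime (k 0) (d : ℤ)) : Submodule.span (RingRd d)
      (Set.range fun i : Fin n => crossedNi k d hk (FreeGroup.of i.succ)) = ⊤ := by
  rw [eq_top_iff]
  rintro v -
  obtain ⟨v, rfl⟩ := V0ni.mk_surjective k d v
  induction v using V0_induction with
  | h0 => rw [map_zero]; exact zero_mem _
  | hadd v w hv hw => rw [map_add]; exact add_mem hv hw
  | hclass a x =>
    rw [map_smul]
    refine Submodule.smul_of_tower_mem _ a ?_
    change classNi k d x ∈ _
    rw [← crossedNi_of_mem hk]
    exact crossedNi_mem_span hk _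

/-! ### The isomorphism with the reduced Gassner representation -/

/-- The homomorphism `K_0(k, d) → R_d^n` obtained by restricting the crossed homomorphism. -/
def crossedK0 {n : ℕ} (k : Fin (n + 1) → ℤ) (d : ℕ) [NeZero d] :
    K0 k d →* Multiplicative (Fin n → RingRd d) where
  toFun x := Multiplicative.ofAdd (crossedAt (fun i => qUnit d ^ k i) x)
  map_one' := by rw [OneMemClass.coe_one, crossedAt_one, ofAdd_zero]
  map_mul' x y := by
    rw [Subgroup.coe_mul, crossedAt_mul, specialise_monoPart_of_mem k d x.2, one_smul, ofAdd_add]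

/-- The map `V_0 → R_d^n` induced by the crossed homomorphism. -/
def toGassnerV0 {n : ℕ} (k : Fin (n + 1) → ℤ) (d : ℕ) [NeZero d] :
    V0 k d →ₗ[ℚ] (Fin n → RingRd d) :=
  (MonoidHom.toAdditiveLeft (Abelianization.lift (crossedK0 k d))).toIntLinearMap.liftBaseChange ℚ

theorem toGassnerV0_class {n : ℕ} (k : Fin (n + 1) → ℤ) (d : ℕ) [NeZero d] (x : K0 k d) :
    toGassnerV0 k d (classV0 k d x) = crossedAt (fun i => qUnit d ^ k i) x := by
  rw [toGassnerV0, classV0, LinearMap.liftBaseChange_tmul, one_smul]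
  rfl

theorem toGassnerV0_qAct {n : ℕ} (k : Fin (n + 1) → ℤ) (d : ℕ) [NeZero d]
    (hk : IsCoprime (k 0) (d : ℤ)) (v : V0 k d) :
    toGassnerV0 k d (qAct k d v) = qElt d • toGassnerV0 k d v := by
  induction v using V0_induction with
  | h0 => simp
  | hadd v w hv hw => simp only [map_add, smul_add, hv, hw]
  | hclass a x =>
    have h : qAct k d (classV0 k d x) = classV0 k d (MulAut.conjNormal (xi k d) x) := rfl
    have h2 : qPow d (Multiplicative.ofAdd 1) = qUnit d := by
      have := qPow_intCast d 1
      rwa [Int.cast_one, zpow_one] at this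
    rw [map_smul, map_smul, map_smul, h, toGassnerV0_class, toGassnerV0_class,
      MulAut.conjNormal_apply, crossedAt_conj _ _ _ (specialise_monoPart_of_mem k d x.2),
      specialise_monoPart, chi_xi k d hk, h2, qUnit_val, smul_comm]

/-- Taking f to be the norm polynomial shows that the map factors through V_0^{ni}; general f gives
R_d-linearity of the factored map. -/
theorem toGassnerV0_aeval {n : ℕ} (k : Fin (n + 1) → ℤ) (d : ℕ) [NeZero d]
    (hk : IsCoprime (k 0) (d : ℤ)) (f : ℚ[X]) (v : V0 k d) :
    toGassnerV0 k d (aeval (qAct k d) f v) =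
      (Ideal.Quotient.mk (Ideal.span {normPoly d}) f) • toGassnerV0 k d v := by
  induction f using Polynomial.induction_on' with
  | add f g hf hg => simp only [map_add, LinearMap.add_apply, hf, hg, add_smul]
  | monomial m a =>
    have h : ∀ m : ℕ, toGassnerV0 k d ((qAct k d ^ m) v) = qElt d ^ m • toGassnerV0 k d v := by
      intro m
      induction m with
      | zero => simp
      | succ m ih =>
        rw [pow_succ', Module.End.mul_apply, toGassnerV0_qAct k d hk, ih, smul_smul, pow_succ']
    have h2 : (Ideal.Quotient.mk (Ideal.span {normPoly d}) (monomial m a)) =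
        a • qElt d ^ m := by
      rw [← C_mul_X_pow_eq_monomial, map_mul, map_pow]
      exact (Algebra.smul_def a (qElt d ^ m)).symm
    rw [aeval_monomial, h2, smul_assoc, ← h]
    simp [Module.algebraMap_end_apply]

/-- The map `V_0^{ni} → R_d^n` induced by the crossed homomorphism. -/
def toGassner {n : ℕ} (k : Fin (n + 1) → ℤ) (d : ℕ) [NeZero d] (hk : IsCoprime (k 0) (d : ℤ)) :
    V0ni k d →ₗ[RingRd d] (Fin n → RingRd d) where
  toFun := (normRange k d).liftQ (toGassnerV0 k d) (by
    rintro _ ⟨v, rfl⟩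
    rw [LinearMap.mem_ker, toGassnerV0_aeval k d hk, Ideal.Quotient.eq_zero_iff_mem.mpr
      (Ideal.mem_span_singleton_self _)]
    exact zero_smul (RingRd d) (toGassnerV0 k d v))
  map_add' := map_add _
  map_smul' r v := by
    obtain ⟨f, rfl⟩ := Ideal.Quotient.mk_surjective r
    obtain ⟨v, rfl⟩ := V0ni.mk_surjective k d v
    have h : (Ideal.Quotient.mk (Ideal.span {normPoly d}) f) • V0ni.mk k d v =
      V0ni.mk k d (aeval (qAct k d) f v) := aeval_qActNi_mk k d f v
    rw [h]
    exact toGassnerV0_aeval k d hk f v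

theorem toGassner_classNi {n : ℕ} (k : Fin (n + 1) → ℤ) (d : ℕ) [NeZero d]
    (hk : IsCoprime (k 0) (d : ℤ)) (x : K0 k d) :
    toGassner k d hk (classNi k d x) = crossedAt (fun i => qUnit d ^ k i) x :=
  toGassnerV0_class k d x

theorem toGassner_homologyRep {n : ℕ} (k : Fin (n + 1) → ℤ) (d : ℕ) [NeZero d]
    (hk : IsCoprime (k 0) (d : ℤ)) (p : pureBraidGroup n) (v : V0ni k d) :
    toGassner k d hk (homologyRep k d p v) =
      reducedGassnerAt (fun i => qUnit d ^ k i) p (toGassner k d hk v) := by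
  obtain ⟨v, rfl⟩ := V0ni.mk_surjective k d v
  change toGassnerV0 k d (pureActionV0 k d p v) = reducedGassnerAt _ p (toGassnerV0 k d v)
  induction v using V0_induction with
  | h0 => simp
  | hadd v w hv hw => simp only [map_add, hv, hw]
  | hclass a x =>
    have h : pureActionV0 k d p (classV0 k d x) = classV0 k d (pureActionK0 k d p x) := rfl
    rw [map_smul, map_smul, map_smul, LinearMap.map_smul_of_tower, h, toGassnerV0_class,
      toGassnerV0_class, pureActionK0_coe,
      crossedAt_pureAction _ _ _ (specialise_monoPart_of_mem k d x.2)]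

/-- Both crossed homomorphisms vanish on the relevant powers of ξ, so agreement on K_0 extends to
all of F_{n+1}. -/
theorem toGassner_crossedNi {n : ℕ} (k : Fin (n + 1) → ℤ) (d : ℕ) [NeZero d]
    (hk : IsCoprime (k 0) (d : ℤ)) (x : FreeGroup (Fin (n + 1))) :
    toGassner k d hk (crossedNi k d hk x) = crossedAt (fun i => qUnit d ^ k i) x := by
  -- Natural m suffices, since `crossedNi` is defined with the reduced residue of χ(x) as lift.
  have h0 : ∀ m : ℕ, crossedAt (fun i => qUnit d ^ k i) (xi k d ^ (-(m : ℤ))) = 0 := by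
    intro m
    have h := crossedAt_inv (fun i => qUnit d ^ k i) (xi k d ^ m)
    rw [xi, ← pow_mul, crossedAt_of_zero_pow, zero_add, specialise_monoPart,
      Units.isUnit _ |>.smul_eq_zero] at h
    rwa [zpow_neg, zpow_natCast, xi, ← pow_mul]
  rw [crossedNi, toGassner_classNi, crossedAt_mul, h0, smul_zero, add_zero]

/-! ### Bijectivity of the comparison map -/

theorem toGassner_surjective {n : ℕ} (k : Fin (n + 1) → ℤ) (d : ℕ) [NeZero d]
    (hk : ∀ i, IsCoprime (k i) (d : ℤ)) : Function.Surjective (toGassner k d (hk 0)) := by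
  rw [← LinearMap.range_eq_top, eq_top_iff, ← (Pi.basisFun (RingRd d) (Fin n)).span_eq,
    Submodule.span_le]
  have h : ∀ i, coordAt (fun i => qUnit d ^ k i) (vSub i) ∈
      LinearMap.range (toGassner k d (hk 0)) := by
    intro i
    -- The generator x_i maps to (1 - q^{k_i})(v_i - v_1). Coprimality of k_i and d allows the
    -- factor to be divided out.
    obtain ⟨u, hu⟩ := isUnit_one_sub_qUnit_zpow d (hk i)
    refine ⟨(u⁻¹ : (RingRd d)ˣ) • crossedNi k d (hk 0) (FreeGroup.of i), ?_⟩
    rw [Units.smul_def, map_smul, toGassner_crossedNi, crossedAt_of, ← hu, smul_smul,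
      Units.inv_mul, one_smul]
  rintro _ ⟨i, rfl⟩
  rw [Pi.basisFun_apply, ← coordAt_epsBasis (fun i => qUnit d ^ k i) i, epsBasis_eq, map_sub]
  exact sub_mem (h _) (h _)

/-- The n spanning elements give a surjection s from R_d^n. The composite with `toGassner` is a
surjective endomorphism of R_d^n, hence injective, and surjectivity of s transfers injectivity to
`toGassner`. -/
theorem toGassner_injective {n : ℕ} (k : Fin (n + 1) → ℤ) (d : ℕ) [NeZero d]
    (hk : ∀ i, IsCoprime (k i) (d : ℤ)) : Function.Injective (toGassner k d (hk 0)) := by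
  set s : (Fin n → RingRd d) →ₗ[RingRd d] V0ni k d :=
    Fintype.linearCombination (RingRd d)
      fun i : Fin n => crossedNi k d (hk 0) (FreeGroup.of i.succ) with hs
  have h1 : Function.Surjective s := by
    rw [← LinearMap.range_eq_top, hs, Fintype.range_linearCombination, span_crossedNi]
  have h2 : Function.Injective (toGassner k d (hk 0) ∘ₗ s) :=
    OrzechProperty.injective_of_surjective_endomorphism _
      ((toGassner_surjective k d hk).comp h1)
  intro v w hvw
  obtain ⟨v, rfl⟩ := h1 v
  obtain ⟨w, rfl⟩ := h1 w
  exact congrArg s (h2 hvw)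

/-- The isomorphism `V_0^{ni} ≅ R_d^n` of `R_d`-modules. -/
def gassnerEquiv {n : ℕ} (k : Fin (n + 1) → ℤ) (d : ℕ) [NeZero d]
    (hk : ∀ i, IsCoprime (k i) (d : ℤ)) : V0ni k d ≃ₗ[RingRd d] (Fin n → RingRd d) :=
  LinearEquiv.ofBijective (toGassner k d (hk 0))
    ⟨toGassner_injective k d hk, toGassner_surjective k d hk⟩

/-! ### The decomposition over `ℚ` -/

/-- The map `R_d^n → ⊕ E_e^n` given by the homomorphisms `R_d → E_e` on the coordinates. -/
def toCyclotomicSum (n d : ℕ) [NeZero d] :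
    (Fin n → RingRd d) →ₗ[ℚ]
      DirectSum (NontrivDivisor d) fun e => Fin n → CyclotomicField (e : ℕ) ℚ :=
  letI := Fintype.ofFinite (NontrivDivisor d)
  (DirectSum.linearEquivFunOnFintype ℚ (NontrivDivisor d)
    fun e => Fin n → CyclotomicField (e : ℕ) ℚ).symm.toLinearMap ∘ₗ
    LinearMap.pi fun e => (toCyclotomic e).toLinearMap.compLeft (Fin n)

theorem toCyclotomicSum_apply (n d : ℕ) [NeZero d] (w : Fin n → RingRd d)
    (e : NontrivDivisor d) : toCyclotomicSum n d w e = toCyclotomic e ∘ w := rfl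

theorem toCyclotomicSum_bijective (n d : ℕ) [NeZero d] :
    Function.Bijective (toCyclotomicSum n d) := by
  constructor
  · rw [injective_iff_map_eq_zero]
    intro w hw
    ext i
    refine toCyclotomic_jointly_injective fun e => ?_
    exact congrFun (DFunLike.congr_fun hw e) i
  · intro z
    choose w hw using fun i : Fin n => toCyclotomic_jointly_surjective fun e => z e i
    refine ⟨w, DFinsupp.ext fun e => funext fun i => ?_⟩
    exact hw i e

theorem toCyclotomicSum_reducedGassnerAt {n : ℕ} (k : Fin (n + 1) → ℤ) (d : ℕ) [NeZero d]
    (p : pureBraidGroup n) (w : Fin n → RingRd d) (e : NontrivDivisor d) :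
    toCyclotomicSum n d (reducedGassnerAt (fun i => qUnit d ^ k i) p w) e =
      gassnerAtRoot k (e : ℕ) p (toCyclotomicSum n d w e) := by
  have h : (fun i => Units.map (toCyclotomic e).toRingHom.toMonoidHom (qUnit d ^ k i)) =
      fun i => omegaUnit (e : ℕ) ^ k i := by
    funext i
    rw [map_zpow]
    congr 1
    exact Units.ext (toCyclotomic_qElt e)
  have h2 := reducedGassnerAt_map (toCyclotomic e).toRingHom (fun i => qUnit d ^ k i) p w
  rw [h] at h2
  exact h2

end PureBraid

end

/-! ### The three statements assembled -/

theorem mainTheorem5 (n d : ℕ) [NeZero d] (hd : 2 ≤ d) (k : Fin (n + 1) → ℤ)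
    (hk : ∀ i, IsCoprime (k i) (d : ℤ)) :
    (Module.Free (PureBraid.RingRd d) (PureBraid.V0ni k d) ∧
      Module.rank (PureBraid.RingRd d) (PureBraid.V0ni k d) = n) ∧
    Nonempty ((PureBraid.homologyRep k d).Equiv
      (PureBraid.reducedGassnerAt fun i => PureBraid.qUnit d ^ k i)) ∧
    ∃ Ψ : (PureBraid.homologyRepQ k d).Equiv
        (Representation.directSum fun e : PureBraid.NontrivDivisor d =>
          PureBraid.gassnerAtRoot k (e : ℕ)),
      ∀ (v : PureBraid.V0ni k d) (e : PureBraid.NontrivDivisor d),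
        Ψ (PureBraid.qElt d • v) e =
          PureBraid.omegaUnit (e : ℕ) • Ψ v e := by
  -- The rank of R_d^n equals n only over a nonzero ring; R_1 is zero, and d ≥ 2 excludes it.
  have hnt := PureBraid.nontrivial_ringRd hd
  refine ⟨⟨Module.Free.of_equiv (PureBraid.gassnerEquiv k d hk).symm, ?_⟩,
    ⟨Representation.Equiv.mk (PureBraid.gassnerEquiv k d hk) fun p =>
      LinearMap.ext fun v => PureBraid.toGassner_homologyRep k d (hk 0) p v⟩,
    Representation.Equiv.mk
      (((PureBraid.gassnerEquiv k d hk).restrictScalars ℚ).trans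
        (LinearEquiv.ofBijective _ (PureBraid.toCyclotomicSum_bijective n d))) ?_, ?_⟩
  · rw [(PureBraid.gassnerEquiv k d hk).rank_eq, rank_fun', Fintype.card_fin]
  · intro p
    refine LinearMap.ext fun v => DFinsupp.ext fun e => ?_
    change PureBraid.toCyclotomicSum n d
      (PureBraid.toGassner k d (hk 0) (PureBraid.homologyRep k d p v)) e = _
    rw [PureBraid.toGassner_homologyRep, PureBraid.toCyclotomicSum_reducedGassnerAt]
    rfl
  · intro v e
    change PureBraid.toCyclotomicSum n d
        (PureBraid.toGassner k d (hk 0) (PureBraid.qElt d • v)) e =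
      PureBraid.omegaUnit (e : ℕ) •
        PureBraid.toCyclotomicSum n d (PureBraid.toGassner k d (hk 0) v) e
    rw [map_smul, PureBraid.toCyclotomicSum_apply, PureBraid.toCyclotomicSum_apply]
    ext i
    rw [Function.comp_apply, Pi.smul_apply, Pi.smul_apply, smul_eq_mul, map_mul,
      PureBraid.toCyclotomic_qElt]
    rfl
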